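/- **Setting.** Let $\mathcal P_0$ be a set of probability laws (the null) on a measurable space $\mathcal X$, let $P_\Omega$ be a probability law for external randomness $\Omega$, and let $L\ge 1$. For every $n$ let $T_n^{(1)},\dots,T_n^{(L)}$ be real measurable functions of $(X,\Omega)$, $X=(X_1,\dots,X_n)$. Let $S:\mathbb R^L\to\mathbb R$ be symmetric and 1-Lipschitz in $\|\cdot\|_\infty$, and put $S_n=S(T_n^{(1)},\dots,T_n^{(L)})$. For a distribution function $F$ write $F^{-1}(p)=\inf\{x:F(x)\ge p\}$, and write $\mathbb F_{\{x_i\}}$ for the empirical distribution function of a finite family $\{x_i\}$. Assume that $(T_n^{(1)},\dots,T_n^{(L)})$ is exchangeable under $(X,\Omega)\sim P^n\times P_\Omega$ for every $P\in\mathcal P_0$ and every $n$, and that $T_n^{(1)}\to_d F_0$ under $P^n\times P_\Omega$ for every $P\in\mathcal P_0$, where $F_0=\mathrm{Unif}(0,1)$ or $F_0=\mathcal N(0,1)$. **The test.** Fix an integer $J\ge 1$ and $\alpha\in(0,1)$. Put $m=\lfloor n/\log n\rfloor$ and $B=J\lfloor n/m\rfloor$. Draw $J$ independent uniformly random permutations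 $\pi$ of $\{1,\dots,n\}$, and cut each into the $\lfloor n/m\rfloor$ disjoint ordered tuples $(\pi_{km+1},\dots,\pi_{km+m})$, $0\le k<\lfloor n/m\rfloor$; this gives $B$ tuples $(i_{1,b},\dots,i_{m,b})$. With fresh independent copies $\Omega_b\sim P_\Omega$ (all of the permutations, the $\Omega_b$ and $(X,\Omega)$ being independent) let $$\hat H_{b,l}=T_m^{(l)}(X_{i_{1,b}},\dots,X_{i_{m,b}};\Omega_b),\qquad \tilde H_{b,l}=F_0^{-1}\Big(\mathbb F_{\hat{\mathbf H}}(\hat H_{b,l})-\tfrac1{2BL}\Big),\qquad \tilde S_b=S(\tilde H_{b,1},\dots,\tilde H_{b,L}),$$ where $\mathbb F_{\hat{\mathbf H}}$ is the empirical distribution function of all $BL$ entries of $\hat{\mathbf H}$, and let $\tilde G_n=\mathbb F_{\{\tilde S_b\}}$. The test rejects if $S_n>\tilde G_n^{-1}(1-\alpha)$. Write $\mathbb P_P$ for probability when the data are iid from $P$. **Theorem.** For every $\alpha\in(0,1)$ the following hold. (i) Suppose that for every $P\in\mathcal P_0$, $S_n\to_d G_P$ under $P^n\times P_\Omega$, where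 $G_P$ is a continuous distribution with a bounded Lebesgue density. Then for every $P\in\mathcal P_0$, $$\mathbb P_P\{S_n>\tilde G_n^{-1}(1-\alpha)\}\to\alpha .$$ (ii) Let $F_{n,P}$ and $G_{n,P}$ be the distribution functions of $T_n^{(1)}$ and $S_n$ under $P^n\times P_\Omega$. Suppose that there are distributions $G_P$, $P\in\mathcal P_0$, such that for every $x\in\mathbb R$ $$\sup_{P\in\mathcal P_0}|F_{n,P}(x)-F_0(x)|\to0,\qquad \sup_{P\in\mathcal P_0}|G_{n,P}(x)-G_P(x)|\to0,$$ and that the $G_P$ have Lebesgue densities bounded by a constant that does not depend on $P\in\mathcal P_0$. Then $$\sup_{P\in\mathcal P_0}\Big|\mathbb P_P\{S_n>\tilde G_n^{-1}(1-\alpha)\}-\alpha\Big|\to0 .$$ -/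

import Mathlib

open MeasureTheory ProbabilityTheory Filter Topology

noncomputable section

namespace RankSubsampling

/-- Empirical distribution function of a finite family of real numbers. -/
def empiricalCDF {ι : Type*} [Fintype ι] (x : ι → ℝ) (t : ℝ) : ℝ :=
  (Nat.card {i : ι // x i ≤ t} : ℝ) / (Fintype.card ι : ℝ)

/-- The quantile `F⁻¹(p) = inf {x : F x ≥ p}`. -/
def quantile (F : ℝ → ℝ) (p : ℝ) : ℝ := sInf {x : ℝ | p ≤ F x}

/-- Subsample size `m = ⌊n / log n⌋`. -/
def subsampleSize (n : ℕ) : ℕ := ⌊(n : ℝ) / Real.log (n : ℝ)⌋₊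

/-- Number `⌊n / m⌋` of disjoint blocks of length `m` in one permutation. -/
def numBlocks (n : ℕ) : ℕ := n / subsampleSize n

/-- The `B = J ⌊n / m⌋` subsamples: a pair (permutation, block). -/
abbrev RowIndex (J n : ℕ) : Type := Fin J × Fin (numBlocks n)

/-- Position `k m + i` (counting from `0`) of the `i`-th entry of block `k`. -/
def blockPosition (n : ℕ) (k : Fin (numBlocks n)) (i : Fin (subsampleSize n)) : Fin n :=
  ⟨(k : ℕ) * subsampleSize n + (i : ℕ), by
    have hk : (k : ℕ) + 1 ≤ n / subsampleSize n := k.isLt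
    have h1 : ((k : ℕ) + 1) * subsampleSize n ≤ n / subsampleSize n * subsampleSize n :=
      Nat.mul_le_mul_right _ hk
    have h2 : n / subsampleSize n * subsampleSize n ≤ n := Nat.div_mul_le_self _ _
    have h3 : ((k : ℕ) + 1) * subsampleSize n = (k : ℕ) * subsampleSize n + subsampleSize n :=
      Nat.succ_mul _ _
    have hi := i.isLt
    omega⟩

/-- The data points `X_{π(km+1)}, …, X_{π(km+m)}` that make up subsample `b = (j, k)`,
where `π` is the `j`-th permutation. -/
def subsample {𝒳 : Type*} {J n : ℕ} (x : Fin n → 𝒳) (π : Fin J → Equiv.Perm (Fin n))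
    (b : RowIndex J n) : Fin (subsampleSize n) → 𝒳 :=
  fun i => x (π b.1 (blockPosition n b.2 i))

/-- Single-split statistics: `T n l (x, ω)` is the value of `T_n^{(l)}` at data
`x = (x_1, …, x_n)` and external randomness `ω`. -/
abbrev Statistics (𝒳 Ω : Type*) (L : ℕ) : Type _ := (n : ℕ) → Fin L → (Fin n → 𝒳) × Ω → ℝ

/-- The aggregated statistic `S_n = S(T_n^{(1)}, …, T_n^{(L)})`. -/
def aggregate {𝒳 Ω : Type*} {L : ℕ} (T : Statistics 𝒳 Ω L) (S : (Fin L → ℝ) → ℝ) (n : ℕ)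
    (z : (Fin n → 𝒳) × Ω) : ℝ :=
  S fun l => T n l z

/-- The `B × L` matrix of statistics computed on the subsamples; subsample `b` is given its own
external randomness `ω b`. -/
def subsampledMatrix {𝒳 Ω : Type*} {L J n : ℕ} (T : Statistics 𝒳 Ω L) (x : Fin n → 𝒳)
    (π : Fin J → Equiv.Perm (Fin n)) (ω : RowIndex J n → Ω) : RowIndex J n → Fin L → ℝ :=
  fun b l => T (subsampleSize n) l (subsample x π b, ω b)

/-- The rank transform of a `B × L` matrix: the entry `h` becomes
`F₀⁻¹(𝔽(h) - 1 / (2BL))`, with `𝔽` the empirical distribution function of all entries. -/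
def rankTransform {ι : Type*} [Fintype ι] {L : ℕ} (F₀ : ℝ → ℝ) (H : ι → Fin L → ℝ) :
    ι → Fin L → ℝ :=
  fun b l => quantile F₀
    (empiricalCDF (fun q : ι × Fin L => H q.1 q.2) (H b l)
      - 1 / (2 * (Fintype.card ι : ℝ) * (L : ℝ)))

/-- The empirical distribution function of the aggregated rows of the rank-transformed matrix. -/
def rankTransformedCDF {𝒳 Ω : Type*} {L J n : ℕ} (T : Statistics 𝒳 Ω L) (S : (Fin L → ℝ) → ℝ)
    (F₀ : ℝ → ℝ) (x : Fin n → 𝒳) (π : Fin J → Equiv.Perm (Fin n)) (ω : RowIndex J n → Ω) :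
    ℝ → ℝ :=
  empiricalCDF fun b : RowIndex J n => S (rankTransform F₀ (subsampledMatrix T x π ω) b)

/-- The finite set of permutations carries the discrete σ-algebra. -/
instance permMeasurableSpace (n : ℕ) : MeasurableSpace (Equiv.Perm (Fin n)) := ⊤

/-- Everything the test draws: the data and the external randomness used for `S_n`; the `J`
permutations; the external randomness used on each subsample. -/
abbrev Draw (𝒳 Ω : Type*) (J n : ℕ) : Type _ :=
  ((Fin n → 𝒳) × Ω) × ((Fin J → Equiv.Perm (Fin n)) × (RowIndex J n → Ω))

/-- The law `Pⁿ × P_Ω` of `(X, Ω)`. -/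
abbrev dataLaw {𝒳 Ω : Type*} [MeasurableSpace 𝒳] [MeasurableSpace Ω]
    (P : Measure 𝒳) (PΩ : Measure Ω) (n : ℕ) : Measure ((Fin n → 𝒳) × Ω) :=
  (Measure.pi fun _ : Fin n => P).prod PΩ

/-- The joint law of everything the test draws: `(X, Ω) ∼ Pⁿ × P_Ω`, `J` independent uniformly
random permutations, and an independent copy of the external randomness for every subsample. -/
abbrev drawLaw {𝒳 Ω : Type*} [MeasurableSpace 𝒳] [MeasurableSpace Ω]
    (P : Measure 𝒳) (PΩ : Measure Ω) (J n : ℕ) : Measure (Draw 𝒳 Ω J n) :=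
  (dataLaw P PΩ n).prod
    ((Measure.pi fun _ : Fin J => (PMF.uniformOfFintype (Equiv.Perm (Fin n))).toMeasure).prod
      (Measure.pi fun _ : RowIndex J n => PΩ))

/-- The event that the aggregated multiple-split test rejects at level `α`:
`S_n` exceeds the upper `α` quantile of the rank-transformed subsampling distribution. -/
def rejectionEvent {𝒳 Ω : Type*} {L : ℕ} (T : Statistics 𝒳 Ω L) (S : (Fin L → ℝ) → ℝ)
    (F₀ : ℝ → ℝ) (α : ℝ) (J n : ℕ) : Set (Draw 𝒳 Ω J n) :=
  {d | quantile (rankTransformedCDF T S F₀ d.1.1 d.2.1 d.2.2) (1 - α) < aggregate T S n d.1}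

/-- Probability of rejection under `P`. -/
def rejectionProb {𝒳 Ω : Type*} [MeasurableSpace 𝒳] [MeasurableSpace Ω] {L : ℕ}
    (T : Statistics 𝒳 Ω L) (S : (Fin L → ℝ) → ℝ) (F₀ : ℝ → ℝ) (PΩ : Measure Ω)
    (α : ℝ) (J n : ℕ) (P : Measure 𝒳) : ℝ :=
  (drawLaw P PΩ J n).real (rejectionEvent T S F₀ α J n)

/-- The random variables `Y l`, for `l` in `Fin L`, are exchangeable under `μ`. -/
def Exchangeable {A : Type*} [MeasurableSpace A] {L : ℕ} (Y : Fin L → A → ℝ) (μ : Measure A) :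
    Prop :=
  ∀ σ : Equiv.Perm (Fin L),
    μ.map (fun a (l : Fin L) => Y (σ l) a) = μ.map (fun a (l : Fin L) => Y l a)

/-- The aggregation function does not depend on the order of its arguments. -/
def SymmetricFun {L : ℕ} (S : (Fin L → ℝ) → ℝ) : Prop :=
  ∀ (σ : Equiv.Perm (Fin L)) (t : Fin L → ℝ), S (fun l => t (σ l)) = S t

/-- `G` has a density with respect to Lebesgue measure that is bounded by `C`. -/
def HasDensityBoundedBy (G : Measure ℝ) (C : ℝ) : Prop :=
  ∃ g : ℝ → ℝ, Measurable g ∧ (∀ x, 0 ≤ g x) ∧ (∀ x, g x ≤ C) ∧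
    G = volume.withDensity fun x => ENNReal.ofReal (g x)

end RankSubsampling

end

/-! The critical value is squeezed between two deterministic points where the limit law of `S_n` has
mass close to `1 - α`. Blocks of one permutation are disjoint, so their statistics are independent
with the law at sample size `m`. An average over all subsamples of a bounded function then has
variance at most `1 / numBlocks n`, which tends to zero. Hence the pooled empirical distribution
function of the entries is close to `F₀`, and that of the untransformed row aggregates is close to
`G P` (`subsample_average_deviation_le`).

The rank transform moves little: if the pooled function is uniformly close to `F₀`, then `F₀⁻¹` of
the shifted rank of `h` is close to `h` for `h` in the bulk of `F₀`. Few rows have an entry outside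
the bulk, and on the others `S` changes by at most `r` because it is 1-Lipschitz in the sup norm. So
the two empirical distribution functions of the aggregates agree up to a shift by `r` and a small
error (`exists_rankTransform_control`); the density bound makes the shift harmless.

`S_n` and the critical value share the data, but a union bound with the exceptional event replaces
independence (`abs_rejectionProb_sub_le`). Uniformity over laws needs one finite grid for all `G P`;
this comes from the common density bound and from tightness inherited from the single-split
statistics (`exists_uniform_tail`). -/

namespace RankSubsampling

/-! ### Weak law of large numbers over subsamples -/

section LawOfLargeNumbers

variable {𝒳 Ω : Type*} [MeasurableSpace 𝒳] [MeasurableSpace Ω]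

/-- Two disjoint tuples of coordinates of an iid sample are independent iid samples. -/
lemma measurePreserving_comp_prodMk_comp {ι₁ ι₂ κ : Type*} [Fintype ι₁] [Fintype ι₂] [Fintype κ]
    (P : Measure 𝒳) [IsProbabilityMeasure P] {f : ι₁ → κ} {g : ι₂ → κ}
    (h : Function.Injective (Sum.elim f g)) :
    MeasurePreserving (fun x : κ → 𝒳 => (fun i => x (f i), fun i => x (g i)))
      (Measure.pi fun _ => P) ((Measure.pi fun _ => P).prod (Measure.pi fun _ => P)) := by
  have h1 : MeasurePreserving (fun (x : κ → 𝒳) (i : ι₁ ⊕ ι₂) => x (Sum.elim f g i))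
      (Measure.pi fun _ => P) (Measure.pi fun _ => P) := by
    refine ⟨by fun_prop, ?_⟩
    have := Measure.map_infinitePi_infinitePi_of_inj (P := fun _ : κ => P) h
    simpa only [Measure.infinitePi_eq_pi] using this
  exact (measurePreserving_sumPiEquivProdPi (fun _ : ι₁ ⊕ ι₂ => P)).comp h1

lemma measurePreserving_eval_prodMk_eval {κ : Type*} [Fintype κ]
    (P : Measure 𝒳) [IsProbabilityMeasure P] {i j : κ} (h : i ≠ j) :
    MeasurePreserving (fun x : κ → 𝒳 => (x i, x j)) (Measure.pi fun _ => P) (P.prod P) := by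
  refine ⟨by fun_prop, ?_⟩
  have := Measure.infinitePi_map_eval_prod (P := fun _ : κ => P) h
  simpa only [Measure.infinitePi_eq_pi] using this

lemma measurePreserving_prodProdProdComm {A B C D : Type*} [MeasurableSpace A] [MeasurableSpace B]
    [MeasurableSpace C] [MeasurableSpace D] (a : Measure A) (b : Measure B) (c : Measure C)
    (d : Measure D) [IsProbabilityMeasure a] [IsProbabilityMeasure b] [IsProbabilityMeasure c]
    [IsProbabilityMeasure d] :
    MeasurePreserving (fun p : (A × B) × (C × D) => ((p.1.1, p.2.1), (p.1.2, p.2.2)))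
      ((a.prod b).prod (c.prod d)) ((a.prod c).prod (b.prod d)) := by
  have h1 := measurePreserving_prodAssoc a b (c.prod d)
  have h2 := (MeasurePreserving.id a).prod ((measurePreserving_prodAssoc b c d).symm)
  have h3 := (MeasurePreserving.id a).prod
    ((Measure.measurePreserving_swap (μ := b) (ν := c)).prod (MeasurePreserving.id d))
  have h4 := (MeasurePreserving.id a).prod (measurePreserving_prodAssoc c b d)
  have h5 := (measurePreserving_prodAssoc a c (b.prod d)).symm
  exact h5.comp (h4.comp (h3.comp (h2.comp h1)))

lemma blockPosition_injective {n : ℕ} {k k' : Fin (numBlocks n)} {i i' : Fin (subsampleSize n)}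
    (h : blockPosition n k i = blockPosition n k' i') : k = k' ∧ i = i' := by
  have h0 : (k : ℕ) * subsampleSize n + i = (k' : ℕ) * subsampleSize n + i' := congrArg Fin.val h
  have hm : 0 < subsampleSize n := i.pos
  have hi : (i : ℕ) = i' := by
    have := congrArg (· % subsampleSize n) h0
    simpa [Nat.add_mod, Nat.mod_eq_of_lt i.2, Nat.mod_eq_of_lt i'.2] using this
  have hk : (k : ℕ) * subsampleSize n = (k' : ℕ) * subsampleSize n := by omega
  exact ⟨Fin.ext (Nat.eq_of_mul_eq_mul_right hm hk), Fin.ext hi⟩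

/-- The data and external randomness of the subsample `b`. -/
noncomputable def subsampleData {J n : ℕ} (d : Draw 𝒳 Ω J n) (b : RowIndex J n) :
    (Fin (subsampleSize n) → 𝒳) × Ω :=
  (subsample d.1.1 d.2.1 b, d.2.2 b)

lemma measurable_subsampleData {J n : ℕ} (b : RowIndex J n) :
    Measurable fun d : Draw 𝒳 Ω J n => subsampleData d b := by
  have h : Measurable fun p : (Fin n → 𝒳) × (Fin J → Equiv.Perm (Fin n)) =>
      subsample p.1 p.2 b :=
    measurable_from_prod_countable_left fun π =>
      measurable_pi_lambda _ fun i => measurable_pi_apply (π b.1 (blockPosition n b.2 i))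
  exact (h.comp (f := fun d : Draw 𝒳 Ω J n => (d.1.1, d.2.1)) (by fun_prop)).prodMk (by fun_prop)

/-- Subsamples from different blocks of the same permutation are independent. -/
lemma measurePreserving_subsampleData_pair (P : Measure 𝒳) [IsProbabilityMeasure P]
    (PΩ : Measure Ω) [IsProbabilityMeasure PΩ] {J n : ℕ} (j : Fin J) {k k' : Fin (numBlocks n)}
    (hk : k ≠ k') :
    MeasurePreserving (fun d : Draw 𝒳 Ω J n => (subsampleData d (j, k), subsampleData d (j, k')))
      (drawLaw P PΩ J n)
      ((dataLaw P PΩ (subsampleSize n)).prod (dataLaw P PΩ (subsampleSize n))) := by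
  have hfst : MeasurePreserving
      (Prod.map Prod.fst id : Draw 𝒳 Ω J n →
        (Fin n → 𝒳) × ((Fin J → Equiv.Perm (Fin n)) × (RowIndex J n → Ω)))
      (drawLaw P PΩ J n) _ :=
    (measurePreserving_fst (μ := Measure.pi fun _ : Fin n => P) (ν := PΩ)).prod
      (MeasurePreserving.id _)
  have hrot := (measurePreserving_prodAssoc
      (Measure.pi fun _ : Fin J => (PMF.uniformOfFintype (Equiv.Perm (Fin n))).toMeasure)
      (Measure.pi fun _ : RowIndex J n => PΩ) (Measure.pi fun _ : Fin n => P)).comp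
    Measure.measurePreserving_swap
  -- With the permutations frozen, the pair already has the product law. This law is the same for
  -- every `π`, so the skew product below integrates `π` out.
  have hpair : ∀ π : Fin J → Equiv.Perm (Fin n), MeasurePreserving
      (fun q : (RowIndex J n → Ω) × (Fin n → 𝒳) =>
        ((subsample q.2 π (j, k), q.1 (j, k)), (subsample q.2 π (j, k'), q.1 (j, k'))))
      ((Measure.pi fun _ : RowIndex J n => PΩ).prod (Measure.pi fun _ : Fin n => P))
      ((dataLaw P PΩ (subsampleSize n)).prod (dataLaw P PΩ (subsampleSize n))) := by
    intro π
    have hinj : Function.Injective (Sum.elim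
        (fun i : Fin (subsampleSize n) => π j (blockPosition n k i))
        (fun i : Fin (subsampleSize n) => π j (blockPosition n k' i))) := by
      refine Function.Injective.sumElim (fun i i' h => ?_) (fun i i' h => ?_) (fun i i' h => ?_)
      · exact (blockPosition_injective ((π j).injective h)).2
      · exact (blockPosition_injective ((π j).injective h)).2
      · exact hk (blockPosition_injective ((π j).injective h)).1
    have h1 := measurePreserving_comp_prodMk_comp P hinj
    have h2 := measurePreserving_eval_prodMk_eval PΩ
      (show ((j, k) : RowIndex J n) ≠ (j, k') by simpa using hk)
    exact (measurePreserving_prodProdProdComm _ _ _ _).comp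
      ((h1.prod h2).comp Measure.measurePreserving_swap)
  have hskew := (MeasurePreserving.id
    (Measure.pi fun _ : Fin J => (PMF.uniformOfFintype (Equiv.Perm (Fin n))).toMeasure)).skew_product
    (μc := (Measure.pi fun _ : RowIndex J n => PΩ).prod (Measure.pi fun _ : Fin n => P))
    (g := fun π q => ((subsample q.2 π (j, k), q.1 (j, k)),
      (subsample q.2 π (j, k'), q.1 (j, k'))))
    (measurable_from_prod_countable_right fun π => (hpair π).measurable)
    (ae_of_all _ fun π => (hpair π).map_eq)
  exact measurePreserving_snd.comp (hskew.comp (hrot.comp hfst))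

/-- A centred bounded function of the subsamples averages to a quantity of small second moment. -/
lemma integral_sq_average_le (P : Measure 𝒳) [IsProbabilityMeasure P]
    (PΩ : Measure Ω) [IsProbabilityMeasure PΩ] {J n : ℕ} (hJ : 0 < J) (hK : 0 < numBlocks n)
    {ψ : (Fin (subsampleSize n) → 𝒳) × Ω → ℝ} (hψ : Measurable ψ) (hb : ∀ z, |ψ z| ≤ 1)
    (h0 : ∫ z, ψ z ∂dataLaw P PΩ (subsampleSize n) = 0) :
    ∫ d, ((∑ b : RowIndex J n, ψ (subsampleData d b)) / (J * numBlocks n : ℝ)) ^ 2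
      ∂drawLaw P PΩ J n ≤ 1 / numBlocks n := by
  set K := numBlocks n
  have hY : ∀ b : RowIndex J n, Measurable fun d : Draw 𝒳 Ω J n => ψ (subsampleData d b) :=
    fun b => hψ.comp (measurable_subsampleData b)
  have hmul : ∀ b b' : RowIndex J n, Integrable
      (fun d : Draw 𝒳 Ω J n => ψ (subsampleData d b) * ψ (subsampleData d b'))
      (drawLaw P PΩ J n) := fun b b' =>
    Integrable.of_bound ((hY b).mul (hY b')).aestronglyMeasurable 1 (ae_of_all _ fun d => by
      rw [Real.norm_eq_abs, abs_mul]
      exact mul_le_one₀ (hb _) (abs_nonneg _) (hb _))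
  -- Distinct blocks are independent and `ψ` is centred, so only the `K` diagonal terms survive.
  have hcross : ∀ (j : Fin J) (k k' : Fin K),
      ∫ d, ψ (subsampleData d (j, k)) * ψ (subsampleData d (j, k')) ∂drawLaw P PΩ J n
        ≤ if k = k' then 1 else 0 := by
    intro j k k'
    split_ifs with h
    · calc _ ≤ ∫ _, (1 : ℝ) ∂drawLaw P PΩ J n := by
            refine integral_mono (hmul _ _) (integrable_const _) fun d => ?_
            exact (le_abs_self _).trans (by
              rw [abs_mul]; exact mul_le_one₀ (hb _) (abs_nonneg _) (hb _))
        _ = 1 := by simp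
    · have hmp := measurePreserving_subsampleData_pair P PΩ (J := J) j h
      have := integral_map (μ := drawLaw P PΩ J n) hmp.measurable.aemeasurable
        (f := fun p : ((Fin (subsampleSize n) → 𝒳) × Ω) × ((Fin (subsampleSize n) → 𝒳) × Ω) =>
          ψ p.1 * ψ p.2) (by rw [hmp.map_eq]; exact Measurable.aestronglyMeasurable (by fun_prop))
      rw [hmp.map_eq, integral_prod_mul, h0] at this
      simp only [mul_zero] at this
      exact this.symm.le
  have hrow : ∀ j : Fin J, ∫ d, (∑ k : Fin K, ψ (subsampleData d (j, k))) ^ 2 ∂drawLaw P PΩ J n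
      ≤ K := by
    intro j
    simp_rw [sq, Finset.sum_mul_sum]
    rw [integral_finsetSum _ fun k _ => integrable_finsetSum _ fun k' _ => hmul _ _]
    calc _ ≤ ∑ k : Fin K, (1 : ℝ) := by
          refine Finset.sum_le_sum fun k _ => ?_
          rw [integral_finsetSum _ fun k' _ => hmul _ _]
          refine (Finset.sum_le_sum fun k' _ => hcross j k k').trans ?_
          simp
      _ = K := by simp
  have hJ' : (0 : ℝ) < J := by exact_mod_cast hJ
  have hK' : (0 : ℝ) < K := by exact_mod_cast hK
  have hint : ∀ j : Fin J, Integrable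
      (fun d : Draw 𝒳 Ω J n => (∑ k : Fin K, ψ (subsampleData d (j, k))) ^ 2)
      (drawLaw P PΩ J n) := fun j => by
    simp_rw [sq, Finset.sum_mul_sum]
    exact integrable_finsetSum _ fun k _ => integrable_finsetSum _ fun k' _ => hmul _ _
  -- Subsamples from different permutations may overlap. Cauchy–Schwarz over `j` avoids their
  -- covariances, and its factor `J` is absorbed by the averaging.
  have hpt : ∀ d : Draw 𝒳 Ω J n,
      ((∑ b : RowIndex J n, ψ (subsampleData d b)) / (J * K : ℝ)) ^ 2
        ≤ (1 / (J * K ^ 2)) * ∑ j : Fin J, (∑ k : Fin K, ψ (subsampleData d (j, k))) ^ 2 := by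
    intro d
    rw [Fintype.sum_prod_type]
    have := sq_sum_le_card_mul_sum_sq (s := (Finset.univ : Finset (Fin J)))
      (f := fun j => ∑ k : Fin K, ψ (subsampleData d (j, k)))
    simp only [Finset.card_univ, Fintype.card_fin] at this
    rw [div_pow, div_le_iff₀ (by positivity)]
    refine this.trans (le_of_eq ?_)
    field_simp
  calc _ ≤ ∫ d, (1 / (J * K ^ 2)) * ∑ j : Fin J, (∑ k : Fin K, ψ (subsampleData d (j, k))) ^ 2
        ∂drawLaw P PΩ J n :=
        integral_mono_of_nonneg (ae_of_all _ fun d => sq_nonneg _)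
          ((integrable_finsetSum _ fun j _ => hint j).const_mul _) (ae_of_all _ hpt)
    _ ≤ (1 / (J * K ^ 2)) * ∑ j : Fin J, (K : ℝ) := by
        rw [integral_const_mul, integral_finsetSum _ fun j _ => hint j]
        exact mul_le_mul_of_nonneg_left (Finset.sum_le_sum fun j _ => hrow j) (by positivity)
    _ = 1 / K := by
        simp only [Finset.sum_const, Finset.card_univ, Fintype.card_fin, nsmul_eq_mul]
        field_simp

/-- Weak law of large numbers for averages over the subsamples. -/
lemma subsample_average_deviation_le (P : Measure 𝒳) [IsProbabilityMeasure P]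
    (PΩ : Measure Ω) [IsProbabilityMeasure PΩ] {J n : ℕ} (hJ : 0 < J) (hK : 0 < numBlocks n)
    {φ : (Fin (subsampleSize n) → 𝒳) × Ω → ℝ} (hφ : Measurable φ) (hφ0 : ∀ z, 0 ≤ φ z)
    (hφ1 : ∀ z, φ z ≤ 1) {δ : ℝ} (hδ : 0 < δ) :
    (drawLaw P PΩ J n).real {d | δ < |(∑ b : RowIndex J n, φ (subsampleData d b)) /
        (J * numBlocks n : ℝ) - ∫ z, φ z ∂dataLaw P PΩ (subsampleSize n)|}
      ≤ 1 / (numBlocks n * δ ^ 2) := by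
  set μ := ∫ z, φ z ∂dataLaw P PΩ (subsampleSize n)
  have hi : Integrable φ (dataLaw P PΩ (subsampleSize n)) :=
    Integrable.of_bound hφ.aestronglyMeasurable 1 (ae_of_all _ fun z => by
      rw [Real.norm_eq_abs, abs_of_nonneg (hφ0 z)]; exact hφ1 z)
  have hμ0 : 0 ≤ μ := integral_nonneg hφ0
  have hμ1 : μ ≤ 1 := by
    calc μ ≤ ∫ _, (1 : ℝ) ∂dataLaw P PΩ (subsampleSize n) :=
          integral_mono hi (integrable_const _) hφ1
      _ = 1 := by simp
  have hψ : Measurable fun z => φ z - μ := by fun_prop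
  have hψb : ∀ z, |φ z - μ| ≤ 1 := fun z => by
    rw [abs_le]; constructor <;> linarith [hφ0 z, hφ1 z]
  have hJ' : (0 : ℝ) < J := by exact_mod_cast hJ
  have hK' : (0 : ℝ) < numBlocks n := by exact_mod_cast hK
  have hsq := integral_sq_average_le P PΩ hJ hK hψ hψb (by
    rw [integral_sub hi (integrable_const _)]; simp [μ])
  have hrw : ∀ d : Draw 𝒳 Ω J n, (∑ b : RowIndex J n, (φ (subsampleData d b) - μ)) /
      (J * numBlocks n : ℝ) = (∑ b : RowIndex J n, φ (subsampleData d b)) /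
        (J * numBlocks n : ℝ) - μ := fun d => by
    rw [Finset.sum_sub_distrib]
    simp only [Finset.sum_const, Finset.card_univ, Fintype.card_prod, Fintype.card_fin,
      nsmul_eq_mul]
    push_cast
    field_simp
  simp_rw [hrw] at hsq
  have hint : Integrable (fun d : Draw 𝒳 Ω J n => ((∑ b : RowIndex J n, φ (subsampleData d b)) /
      (J * numBlocks n : ℝ) - μ) ^ 2) (drawLaw P PΩ J n) := by
    have hm : Measurable fun d : Draw 𝒳 Ω J n => ((∑ b : RowIndex J n, φ (subsampleData d b)) /
        (J * numBlocks n : ℝ) - μ) ^ 2 :=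
      (((Finset.measurable_sum _ fun b _ =>
        hφ.comp (measurable_subsampleData b)).div_const _).sub_const _).pow_const 2
    refine Integrable.of_bound hm.aestronglyMeasurable 1 (ae_of_all _ fun d => ?_)
    rw [Real.norm_eq_abs, abs_pow, ← hrw, abs_div,
      abs_of_pos (show (0 : ℝ) < J * numBlocks n by positivity)]
    refine pow_le_one₀ (by positivity) ?_
    rw [div_le_one (by positivity)]
    refine (Finset.abs_sum_le_sum_abs _ _).trans ((Finset.sum_le_sum fun b _ => hψb _).trans ?_)
    simp
  -- Chebyshev's inequality, as Markov's for the square.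
  have hmk := mul_meas_ge_le_integral_of_nonneg (ae_of_all _ fun d => sq_nonneg _) hint (δ ^ 2)
  have hsub : (drawLaw P PΩ J n).real {d | δ < |(∑ b : RowIndex J n, φ (subsampleData d b)) /
        (J * numBlocks n : ℝ) - μ|} ≤ (drawLaw P PΩ J n).real
      {d | δ ^ 2 ≤ ((∑ b : RowIndex J n, φ (subsampleData d b)) /
        (J * numBlocks n : ℝ) - μ) ^ 2} := by
    refine measureReal_mono fun d hd => ?_
    simp only [Set.mem_ofPred_eq] at hd ⊢
    rw [← sq_abs (_ - _)]
    gcongr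
  rw [le_div_iff₀ (by positivity)]
  have h3 := hmk.trans hsq
  rw [le_div_iff₀ hK'] at h3
  calc _ ≤ (drawLaw P PΩ J n).real {d | δ ^ 2 ≤ ((∑ b : RowIndex J n, φ (subsampleData d b)) /
        (J * numBlocks n : ℝ) - μ) ^ 2} * (numBlocks n * δ ^ 2) := by gcongr
    _ ≤ 1 := by linarith

end LawOfLargeNumbers

/-! ### Empirical distribution functions, quantiles and the rank transform -/

section Quantiles

lemma empiricalCDF_eq_sum {ι : Type*} [Fintype ι] (x : ι → ℝ) (t : ℝ) :
    empiricalCDF x t = (∑ i, if x i ≤ t then (1 : ℝ) else 0) / Fintype.card ι := by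
  classical
  rw [empiricalCDF, Nat.card_eq_fintype_card, Fintype.card_subtype, Finset.sum_boole]

lemma monotone_empiricalCDF {ι : Type*} [Fintype ι] (x : ι → ℝ) : Monotone (empiricalCDF x) := by
  intro s t hst
  rw [empiricalCDF_eq_sum, empiricalCDF_eq_sum]
  gcongr with i
  split_ifs with h1 h2 <;> first | exact absurd (h1.trans hst) h2 | norm_num

lemma empiricalCDF_nonneg {ι : Type*} [Fintype ι] (x : ι → ℝ) (t : ℝ) : 0 ≤ empiricalCDF x t := by
  unfold empiricalCDF
  positivity

lemma empiricalCDF_le_one {ι : Type*} [Fintype ι] (x : ι → ℝ) (t : ℝ) : empiricalCDF x t ≤ 1 := by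
  rw [empiricalCDF_eq_sum]
  refine div_le_one_of_le₀ ?_ (by positivity)
  refine (Finset.sum_le_sum (g := fun _ => (1 : ℝ)) fun i _ => ?_).trans (by simp)
  split_ifs <;> norm_num

/-- The point `a` bounds the level set from below and `b` belongs to it, so the `sInf` is a genuine
infimum and not the default value `0`. -/
lemma le_quantile_and_quantile_le {F : ℝ → ℝ} (hF : Monotone F) {a b p : ℝ} (ha : F a < p)
    (hb : p ≤ F b) : a ≤ quantile F p ∧ quantile F p ≤ b := by
  have hlow : ∀ x ∈ {x : ℝ | p ≤ F x}, a ≤ x := fun x hx =>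
    le_of_not_gt fun hxa => absurd (ha.trans_le hx) (not_lt.2 (hF hxa.le))
  exact ⟨le_csInf ⟨b, hb⟩ hlow, csInf_le ⟨a, hlow⟩ hb⟩

/-- Pólya's theorem for a class of uniformly tight and uniformly Lipschitz limits: closeness of
monotone functions on a suitable finite set implies uniform closeness. -/
lemma exists_finset_forall_abs_sub_le {C M δ : ℝ} (hC : 0 ≤ C) (hδ : 0 < δ) :
    ∃ D : Finset ℝ, ∀ F H : ℝ → ℝ, Monotone F → Monotone H →
      (∀ x, 0 ≤ F x) → (∀ x, F x ≤ 1) → (∀ x, 0 ≤ H x) → (∀ x, H x ≤ 1) →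
      (∀ x y, x ≤ y → F y - F x ≤ C * (y - x)) → F (-M) ≤ δ → 1 - δ ≤ F M →
      (∀ t ∈ D, |H t - F t| ≤ δ) → ∀ x, |H x - F x| ≤ 2 * δ := by
  -- Grid mesh over which `F` grows by at most `δ`; the `+ 1` allows `C = 0`.
  set s := δ / (C + 1) with hs
  have hs0 : 0 < s := by positivity
  have hCs : C * s ≤ δ := by
    rw [hs, mul_div_assoc', div_le_iff₀ (by positivity)]
    nlinarith
  obtain ⟨N, hN⟩ := exists_nat_ge (2 * M / s)
  rw [div_le_iff₀ hs0] at hN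
  -- Point `N` lies at or beyond `M`; point `N + 1` closes the last cell when the floor below equals
  -- `N`.
  refine ⟨(Finset.range (N + 2)).image fun i : ℕ => -M + i * s, ?_⟩
  intro F H hF hH hF0 hF1 hH0 hH1 hlip hl hr hD x
  have hgrid : ∀ i : ℕ, i < N + 2 → |H (-M + i * s) - F (-M + i * s)| ≤ δ := fun i hi =>
    hD _ (Finset.mem_image_of_mem _ (Finset.mem_range.2 hi))
  rcases lt_or_ge x (-M) with hx | hx
  · have h0 := hgrid 0 (by omega)
    simp only [Nat.cast_zero, zero_mul, add_zero] at h0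
    have := hF hx.le
    have := hH hx.le
    rw [abs_le] at h0 ⊢
    constructor <;> linarith [hF0 x, hH0 x]
  rcases lt_or_ge (-M + N * s) x with hx' | hx'
  · have h0 := hgrid N (by omega)
    have := hF hx'.le
    have := hH hx'.le
    have := hF (show M ≤ -M + N * s by linarith)
    rw [abs_le] at h0 ⊢
    constructor <;> linarith [hF1 x, hH1 x]
  · have hi0 : 0 ≤ (x + M) / s := div_nonneg (by linarith) hs0.le
    set i := ⌊(x + M) / s⌋₊ with hi
    have h1 : (i : ℝ) * s ≤ x + M := (le_div_iff₀ hs0).1 (Nat.floor_le hi0)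
    have h2 : x + M < ((i + 1 : ℕ) : ℝ) * s := by
      push_cast
      exact (div_lt_iff₀ hs0).1 (Nat.lt_floor_add_one _)
    have hiN : i ≤ N := by
      rw [hi]
      refine Nat.floor_le_of_le ?_
      rw [div_le_iff₀ hs0]
      linarith
    have g1 := hgrid i (by omega)
    have g2 := hgrid (i + 1) (by omega)
    have l := hlip (-M + i * s) (-M + ((i + 1 : ℕ) : ℝ) * s) (by linarith)
    have e : C * ((-M + ((i + 1 : ℕ) : ℝ) * s) - (-M + i * s)) = C * s := by push_cast; ring
    rw [e] at l
    have m1 := hF (show -M + i * s ≤ x by linarith)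
    have m2 := hF (show x ≤ -M + ((i + 1 : ℕ) : ℝ) * s by linarith)
    have m3 := hH (show -M + i * s ≤ x by linarith)
    have m4 := hH (show x ≤ -M + ((i + 1 : ℕ) : ℝ) * s by linarith)
    rw [abs_le] at g1 g2 ⊢
    constructor <;> linarith

/-- The quantile function of a strictly increasing distribution function inverts every uniformly
close function on the bulk of the distribution. -/
lemma exists_quantile_sub_le {F : ℝ → ℝ} (hF : Monotone F) (hc : Continuous F)
    (hstrict : ∀ x y, x < y → F x < 1 → 0 < F y → F x < F y) {u v r : ℝ} (hu : 0 < F u)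
    (hv : F v < 1) (hr : 0 < r) :
    ∃ δ > 0, ∀ F' : ℝ → ℝ, (∀ t, |F' t - F t| ≤ δ) → ∀ h ∈ Set.Icc u v, ∀ c, 0 ≤ c → c ≤ δ →
      |quantile F (F' h - c) - h| ≤ r := by
  rcases (Set.Icc u v).eq_empty_or_nonempty with he | hne
  · exact ⟨1, one_pos, fun F' _ h hh => by rw [he] at hh; exact hh.elim⟩
  -- By compactness, the increments of `F` over steps of length `r` on either side of the bulk
  -- points have a common positive lower bound `g`.
  obtain ⟨z, hz, hmin⟩ := isCompact_Icc.exists_isMinOn hne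
    (show ContinuousOn (fun h => min (F h - F (h - r)) (F (h + r) - F h)) (Set.Icc u v) by fun_prop)
  have hpos : 0 < min (F z - F (z - r)) (F (z + r) - F z) := by
    have h1 : F u ≤ F z := hF hz.1
    have h2 : F z ≤ F v := hF hz.2
    have h3 : F (z - r) ≤ F z := hF (by linarith)
    have h4 : F z ≤ F (z + r) := hF (by linarith)
    refine lt_min (sub_pos.2 (hstrict _ _ (by linarith) ?_ ?_))
      (sub_pos.2 (hstrict _ _ (by linarith) ?_ ?_)) <;> linarith
  set g := min (F z - F (z - r)) (F (z + r) - F z)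
  -- The error of `F'` and the offset `c` together cost at most `2 * g / 3`, which keeps the
  -- inequality at `h - r` strict.
  refine ⟨g / 3, by positivity, fun F' hF' h hh c hc0 hc1 => ?_⟩
  have hg : g ≤ min (F h - F (h - r)) (F (h + r) - F h) := hmin hh
  have hg1 := hg.trans (min_le_left _ _)
  have hg2 := hg.trans (min_le_right _ _)
  have hh' := abs_le.1 (hF' h)
  obtain ⟨h1, h2⟩ := le_quantile_and_quantile_le hF (a := h - r) (b := h + r) (p := F' h - c)
    (by linarith) (by linarith)
  rw [abs_le]
  constructor <;> linarith

/-- If two families of reals are `r`-close in all rows whose entries lie in `(u, v]`, their empirical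
distribution functions are close up to a shift by `r` and the proportion of the other rows. -/
lemma empiricalCDF_le_add_shift {ι : Type*} [Fintype ι] [Nonempty ι] {L : ℕ} [NeZero L]
    (H : ι → Fin L → ℝ) {a b : ι → ℝ} {u v r : ℝ} (huv : u ≤ v)
    (h : ∀ i, (∀ l, u < H i l ∧ H i l ≤ v) → |a i - b i| ≤ r) (x : ℝ) :
    empiricalCDF a x ≤ empiricalCDF b (x + r) + L *
      (empiricalCDF (fun q : ι × Fin L => H q.1 q.2) u
        + (1 - empiricalCDF (fun q : ι × Fin L => H q.1 q.2) v)) := by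
  have hL : (0 : ℝ) < L := by exact_mod_cast Nat.pos_of_ne_zero (NeZero.ne L)
  have hι : (0 : ℝ) < Fintype.card ι := by exact_mod_cast Fintype.card_pos
  -- A bad row is charged to its entries outside `(u, v]`, of which it has at least one. Dividing by
  -- the number of rows instead of entries yields the factor `L`.
  have hpt : ∀ i, (if a i ≤ x then (1 : ℝ) else 0) ≤ (if b i ≤ x + r then (1 : ℝ) else 0)
      + ∑ l : Fin L, ((if H i l ≤ u then (1 : ℝ) else 0)
        + (1 - if H i l ≤ v then (1 : ℝ) else 0)) := by
    intro i
    have hnn : ∀ l ∈ Finset.univ, (0 : ℝ) ≤ (if H i l ≤ u then (1 : ℝ) else 0)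
        + (1 - if H i l ≤ v then (1 : ℝ) else 0) := fun l _ => by split_ifs <;> norm_num
    by_cases hi : ∀ l, u < H i l ∧ H i l ≤ v
    · have h1 := abs_le.1 (h i hi)
      have h2 : (if a i ≤ x then (1 : ℝ) else 0) ≤ (if b i ≤ x + r then (1 : ℝ) else 0) := by
        split_ifs <;> linarith
      linarith [Finset.sum_nonneg hnn]
    · push Not at hi
      obtain ⟨l, hl⟩ := hi
      have h1 := Finset.single_le_sum hnn (Finset.mem_univ l)
      have h2 : (1 : ℝ) ≤ (if H i l ≤ u then (1 : ℝ) else 0)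
          + (1 - if H i l ≤ v then (1 : ℝ) else 0) := by
        rcases lt_or_ge u (H i l) with h3 | h3
        · rw [if_neg (not_le.2 (hl h3)), if_neg (not_le.2 h3)]; norm_num
        · rw [if_pos h3, if_pos (h3.trans huv)]; norm_num
      have h3 : (if a i ≤ x then (1 : ℝ) else 0) ≤ 1 := by split_ifs <;> norm_num
      have h4 : (0 : ℝ) ≤ if b i ≤ x + r then (1 : ℝ) else 0 := by split_ifs <;> norm_num
      linarith
  have hsum := Finset.sum_le_sum fun i (_ : i ∈ Finset.univ) => hpt i
  simp only [Finset.sum_add_distrib, Finset.sum_sub_distrib, Finset.sum_const, Finset.card_univ,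
    Fintype.card_fin, nsmul_eq_mul, mul_one] at hsum
  simp only [empiricalCDF_eq_sum, Fintype.sum_prod_type, Fintype.card_prod, Fintype.card_fin,
    Nat.cast_mul]
  rw [div_le_iff₀ hι]
  refine hsum.trans (le_of_eq ?_)
  field_simp

/-- If the entries of a matrix have an empirical distribution function close to `F₀`, aggregating
the rows before or after the rank transform gives close empirical distribution functions. -/
lemma exists_rankTransform_control {F₀ : ℝ → ℝ} (hF : Monotone F₀) (hF0 : ∀ x, 0 ≤ F₀ x)
    (hF1 : ∀ x, F₀ x ≤ 1) (hbot : Tendsto F₀ atBot (𝓝 0)) (htop : Tendsto F₀ atTop (𝓝 1))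
    {C : ℝ} (hC : 0 ≤ C) (hlip : ∀ x y, x ≤ y → F₀ y - F₀ x ≤ C * (y - x)) (hcont : Continuous F₀)
    (hstrict : ∀ x y, x < y → F₀ x < 1 → 0 < F₀ y → F₀ x < F₀ y) {L : ℕ} [NeZero L]
    {S : (Fin L → ℝ) → ℝ} (hS : LipschitzWith 1 S) {η r : ℝ} (hη : 0 < η) (hr : 0 < r) :
    ∃ D : Finset ℝ, ∃ δ > 0, ∀ (ι : Type) [Fintype ι] [Nonempty ι] (H : ι → Fin L → ℝ),
      1 / (2 * (Fintype.card ι : ℝ) * (L : ℝ)) ≤ δ →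
      (∀ t ∈ D, |empiricalCDF (fun q : ι × Fin L => H q.1 q.2) t - F₀ t| ≤ δ) →
      ∀ x, empiricalCDF (fun b => S (rankTransform F₀ H b)) x
            ≤ empiricalCDF (fun b => S (H b)) (x + r) + L * η ∧
        empiricalCDF (fun b => S (H b)) (x - r)
            ≤ empiricalCDF (fun b => S (rankTransform F₀ H b)) x + L * η := by
  -- Each tail outside the bulk has mass `θ ≤ η / 4`, and the empirical error `2 * δ ≤ η / 4` is
  -- added at each end, `η` in all. The cap `1 / 4` gives `u ≤ v`.
  set θ := min (η / 4) (1 / 4) with hθ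
  have hθ0 : 0 < θ := lt_min (by positivity) (by norm_num)
  have hθ1 : θ ≤ η / 4 := min_le_left _ _
  have hθ2 : θ ≤ 1 / 4 := min_le_right _ _
  have hivt : ∀ p, 0 < p → p < 1 → ∃ x, F₀ x = p := fun p hp0 hp1 =>
    mem_range_of_exists_le_of_exists_ge hcont ((hbot.eventually (gt_mem_nhds hp0)).exists.imp
      fun _ h => h.le) ((htop.eventually (lt_mem_nhds hp1)).exists.imp fun _ h => h.le)
  obtain ⟨u, hu⟩ := hivt θ hθ0 (by linarith)
  obtain ⟨v, hv⟩ := hivt (1 - θ) (by linarith) (by linarith)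
  have huv : u ≤ v := le_of_not_gt fun hvu => by
    have := hF hvu.le
    linarith
  obtain ⟨δ₁, hδ₁, hq⟩ := exists_quantile_sub_le hF hcont hstrict (u := u) (v := v) (r := r)
    (by linarith) (by linarith) hr
  set δ := min (δ₁ / 2) (η / 8) with hδ
  have hδ0 : 0 < δ := lt_min (by positivity) (by positivity)
  have hδ1 : δ ≤ δ₁ / 2 := min_le_left _ _
  have hδ2 : δ ≤ η / 8 := min_le_right _ _
  obtain ⟨M, hM1, hM2⟩ : ∃ M, F₀ (-M) ≤ δ ∧ 1 - δ ≤ F₀ M := by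
    have h1 : ∀ᶠ M : ℝ in atTop, F₀ (-M) < δ :=
      (hbot.comp tendsto_neg_atTop_atBot).eventually (gt_mem_nhds hδ0)
    have h2 : ∀ᶠ M : ℝ in atTop, 1 - δ < F₀ M :=
      htop.eventually (lt_mem_nhds (by linarith))
    obtain ⟨M, h1, h2⟩ := (h1.and h2).exists
    exact ⟨M, h1.le, h2.le⟩
  obtain ⟨D, hD⟩ := exists_finset_forall_abs_sub_le (M := M) hC hδ0
  refine ⟨D, δ, hδ0, fun ι _ _ H hcard hclose x => ?_⟩
  have hunif := hD F₀ (empiricalCDF fun q : ι × Fin L => H q.1 q.2) hF (monotone_empiricalCDF _)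
    hF0 hF1 (empiricalCDF_nonneg _) (empiricalCDF_le_one _) hlip hM1 hM2 hclose
  have hrow : ∀ b, (∀ l, u < H b l ∧ H b l ≤ v) → |S (rankTransform F₀ H b) - S (H b)| ≤ r := by
    intro b hb
    have h1 := hS.dist_le_mul (rankTransform F₀ H b) (H b)
    rw [NNReal.coe_one, one_mul, Real.dist_eq] at h1
    refine h1.trans ((dist_pi_le_iff hr.le).2 fun l => ?_)
    rw [Real.dist_eq]
    exact hq _ (fun t => (hunif t).trans (by linarith)) _ ⟨(hb l).1.le, (hb l).2⟩ _
      (by positivity) (by linarith)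
  have hbad : (L : ℝ) * (empiricalCDF (fun q : ι × Fin L => H q.1 q.2) u
        + (1 - empiricalCDF (fun q : ι × Fin L => H q.1 q.2) v)) ≤ L * η := by
    have h1 := abs_le.1 (hunif u)
    have h2 := abs_le.1 (hunif v)
    gcongr
    linarith
  have h1 := empiricalCDF_le_add_shift H huv hrow x
  have h2 := empiricalCDF_le_add_shift H (a := fun b => S (H b)) huv
    (fun b hb => by rw [abs_sub_comm]; exact hrow b hb) (x - r)
  rw [sub_add_cancel] at h2
  exact ⟨h1.trans (by gcongr), h2.trans (by gcongr)⟩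

end Quantiles

/-! ### Distribution functions under a bounded density -/

section Distributions

lemma cdf_map_eq_real {A : Type*} [MeasurableSpace A] (μ : Measure A) [IsProbabilityMeasure μ]
    {Y : A → ℝ} (hY : Measurable Y) (x : ℝ) : cdf (μ.map Y) x = μ.real {a | Y a ≤ x} := by
  have := Measure.isProbabilityMeasure_map (μ := μ) hY.aemeasurable
  rw [cdf_eq_real, map_measureReal_apply hY measurableSet_Iic]
  rfl

lemma HasDensityBoundedBy.nonneg {G : Measure ℝ} {C : ℝ} (h : HasDensityBoundedBy G C) : 0 ≤ C := by
  obtain ⟨g, -, h0, h1, -⟩ := h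
  exact (h0 0).trans (h1 0)

lemma HasDensityBoundedBy.cdf_sub_le {G : Measure ℝ} [IsProbabilityMeasure G] {C : ℝ}
    (h : HasDensityBoundedBy G C) {x y : ℝ} (hxy : x ≤ y) :
    cdf G y - cdf G x ≤ C * (y - x) := by
  have hC := h.nonneg
  obtain ⟨g, hg, h0, h1, hG⟩ := h
  have h2 : cdf G y - cdf G x = G.real (Set.Ioc x y) := by
    rw [cdf_eq_real, cdf_eq_real, ← Set.Iic_union_Ioc_eq_Iic hxy,
      measureReal_union (Set.Iic_disjoint_Ioc le_rfl) measurableSet_Ioc]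
    ring
  rw [h2, measureReal_def]
  refine ENNReal.toReal_le_of_le_ofReal (mul_nonneg hC (sub_nonneg.2 hxy)) ?_
  rw [hG, withDensity_apply _ measurableSet_Ioc]
  calc ∫⁻ z in Set.Ioc x y, ENNReal.ofReal (g z)
      ≤ ∫⁻ _ in Set.Ioc x y, ENNReal.ofReal C :=
        lintegral_mono fun z => ENNReal.ofReal_le_ofReal (h1 z)
    _ = ENNReal.ofReal (C * (y - x)) := by
        rw [setLIntegral_const, Real.volume_Ioc, ENNReal.ofReal_mul hC]

lemma HasDensityBoundedBy.continuous_cdf {G : Measure ℝ} [IsProbabilityMeasure G] {C : ℝ}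
    (h : HasDensityBoundedBy G C) : Continuous (cdf G) := by
  refine (LipschitzWith.of_le_add_mul C.toNNReal fun x y => ?_).continuous
  rw [Real.coe_toNNReal _ h.nonneg, Real.dist_eq]
  rcases le_total y x with hxy | hxy
  · have := h.cdf_sub_le hxy
    rw [abs_of_nonneg (sub_nonneg.2 hxy)]
    linarith
  · have := monotone_cdf G hxy
    have := mul_nonneg h.nonneg (abs_nonneg (x - y))
    linarith

lemma hasDensityBoundedBy_uniform :
    HasDensityBoundedBy (volume.restrict (Set.Ioo (0 : ℝ) 1)) 1 := by
  refine ⟨(Set.Ioo (0 : ℝ) 1).indicator 1, measurable_one.indicator measurableSet_Ioo,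
    fun x => Set.indicator_nonneg (fun _ _ => zero_le_one) _,
    fun x => Set.indicator_le' (fun _ _ => le_rfl) (fun _ _ => zero_le_one) _, ?_⟩
  rw [← withDensity_indicator_one measurableSet_Ioo]
  congr 1
  ext x
  by_cases hx : x ∈ Set.Ioo (0 : ℝ) 1 <;> simp [hx]

lemma hasDensityBoundedBy_gaussian : HasDensityBoundedBy (gaussianReal 0 1) 1 := by
  refine ⟨gaussianPDFReal 0 1, measurable_gaussianPDFReal 0 1, gaussianPDFReal_nonneg 0 1,
    fun x => ?_, by rw [gaussianReal_of_var_ne_zero _ one_ne_zero]; rfl⟩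
  have h1 : (1 : ℝ) ≤ √(2 * Real.pi * (1 : NNReal)) := by
    rw [Real.one_le_sqrt]
    norm_num
    linarith [Real.pi_gt_three]
  rw [gaussianPDFReal]
  refine mul_le_one₀ (inv_le_one_of_one_le₀ h1) (Real.exp_nonneg _) (Real.exp_le_one_iff.2 ?_)
  exact div_nonpos_of_nonpos_of_nonneg (neg_nonpos.2 (sq_nonneg _)) (by norm_num)

/-- The two conditions on the values exclude the plateaus of the uniform law: they force `x < 1` and
`0 < y`, so `(x, y]` meets `(0, 1)` in positive length. In the Gaussian case Lebesgue measure is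
absolutely continuous with respect to the law. -/
lemma cdf_lt_cdf_of_uniform_or_gaussian {F₀ : Measure ℝ} [IsProbabilityMeasure F₀]
    (hF₀ : F₀ = volume.restrict (Set.Ioo (0 : ℝ) 1) ∨ F₀ = gaussianReal 0 1) {x y : ℝ}
    (hxy : x < y) (hx : cdf F₀ x < 1) (hy : 0 < cdf F₀ y) : cdf F₀ x < cdf F₀ y := by
  have h2 : cdf F₀ y = cdf F₀ x + F₀.real (Set.Ioc x y) := by
    rw [cdf_eq_real, cdf_eq_real, ← Set.Iic_union_Ioc_eq_Iic hxy.le,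
      measureReal_union (Set.Iic_disjoint_Ioc le_rfl) measurableSet_Ioc]
  suffices F₀ (Set.Ioc x y) ≠ 0 by
    rw [h2, lt_add_iff_pos_right]
    exact ENNReal.toReal_pos this (measure_ne_top _ _)
  rcases hF₀ with rfl | rfl
  · have hx1 : x < 1 := by
      by_contra! h
      refine hx.ne ?_
      rw [cdf_eq_real, measureReal_restrict_apply measurableSet_Iic,
        Set.inter_eq_right.2 fun z hz => hz.2.le.trans h]
      simp
    have hy0 : 0 < y := by
      by_contra! h
      refine hy.ne' ?_
      rw [cdf_eq_real, measureReal_restrict_apply measurableSet_Iic,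
        show Set.Iic y ∩ Set.Ioo (0 : ℝ) 1 = ∅ from
          Set.eq_empty_of_forall_notMem fun z hz => absurd (hz.1.trans h) (not_le.2 hz.2.1)]
      simp
    rw [Measure.restrict_apply measurableSet_Ioc]
    have hsub : Set.Ioo (max x 0) (min y 1) ⊆ Set.Ioc x y ∩ Set.Ioo (0 : ℝ) 1 := fun z hz =>
      ⟨⟨(le_max_left _ _).trans_lt hz.1, hz.2.le.trans (min_le_left _ _)⟩,
        (le_max_right _ _).trans_lt hz.1, hz.2.trans_le (min_le_right _ _)⟩
    refine ((?_ : (0 : ENNReal) < volume (Set.Ioo (max x 0) (min y 1))).trans_le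
      (measure_mono hsub)).ne'
    rw [Real.volume_Ioo, ENNReal.ofReal_pos, sub_pos]
    exact max_lt (lt_min hxy hx1) (lt_min hy0 zero_lt_one)
  · intro h0
    have h3 : volume (Set.Ioc x y) = 0 :=
      gaussianReal_absolutelyContinuous' 0 one_ne_zero h0
    rw [Real.volume_Ioc, ENNReal.ofReal_eq_zero] at h3
    linarith

/-- Convergence in distribution gives convergence of distribution functions when the limit has a
continuous distribution function. -/
lemma tendsto_cdf_map_of_tendstoInDistribution {A : ℕ → Type*} [∀ n, MeasurableSpace (A n)]
    {μ : ∀ n, Measure (A n)} [∀ n, IsProbabilityMeasure (μ n)] {Y : ∀ n, A n → ℝ} {G : Measure ℝ}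
    [IsProbabilityMeasure G] (h : TendstoInDistribution Y atTop (id : ℝ → ℝ) μ G)
    {C : ℝ} (hG : HasDensityBoundedBy G C) (x : ℝ) :
    Tendsto (fun n => cdf ((μ n).map (Y n)) x) atTop (𝓝 (cdf G x)) := by
  have hfr : G (frontier (Set.Iic x)) = 0 := by
    rw [frontier_Iic]
    obtain ⟨g, -, -, -, rfl⟩ := hG
    exact withDensity_absolutelyContinuous _ _ (measure_singleton x)
  have := ProbabilityMeasure.tendsto_measure_of_null_frontier_of_tendsto' h.tendsto
    (E := Set.Iic x) (by simpa using hfr)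
  simp only [ProbabilityMeasure.coe_mk, Measure.map_id] at this
  have h2 := (ENNReal.tendsto_toReal (measure_ne_top G _)).comp this
  refine (h2.congr fun n => ?_).trans_eq ?_
  · have := Measure.isProbabilityMeasure_map (h.forall_aemeasurable n)
    rw [cdf_eq_real]
    rfl
  · rw [cdf_eq_real]
    rfl

end Distributions

/-! ### Growth of the subsample size and concentration of the subsampled statistics -/

section Subsamples

lemma tendsto_div_log_atTop : Tendsto (fun n : ℕ => (n : ℝ) / Real.log n) atTop atTop := by
  have h1 : Tendsto (fun x : ℝ => Real.log x / x) atTop (𝓝[>] 0) := by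
    refine tendsto_nhdsWithin_iff.2 ⟨?_, ?_⟩
    · simpa using Real.isLittleO_log_id_atTop.tendsto_div_nhds_zero
    · filter_upwards [eventually_gt_atTop 1] with x hx
      exact div_pos (Real.log_pos hx) (by linarith)
  refine (h1.inv_tendsto_nhdsGT_zero.comp tendsto_natCast_atTop_atTop).congr fun n => ?_
  simp

lemma tendsto_subsampleSize : Tendsto subsampleSize atTop atTop :=
  tendsto_nat_floor_atTop.comp tendsto_div_log_atTop

/-- Since `m ≤ n / log n`, at least `⌊log n⌋` blocks of length `m` fit into `n`. -/
lemma tendsto_numBlocks : Tendsto numBlocks atTop atTop := by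
  have hlog : Tendsto (fun n : ℕ => ⌊Real.log n⌋₊) atTop atTop :=
    tendsto_nat_floor_atTop.comp (Real.tendsto_log_atTop.comp tendsto_natCast_atTop_atTop)
  refine tendsto_atTop_mono' _ ?_ hlog
  filter_upwards [tendsto_subsampleSize.eventually_gt_atTop 0, eventually_gt_atTop 1] with n hm hn
  rw [numBlocks, Nat.le_div_iff_mul_le hm, ← Nat.cast_le (α := ℝ), Nat.cast_mul]
  have hl : 0 < Real.log n := Real.log_pos (by exact_mod_cast hn)
  calc (⌊Real.log n⌋₊ : ℝ) * subsampleSize n ≤ Real.log n * (n / Real.log n) := by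
        gcongr
        · exact Nat.floor_le hl.le
        · exact Nat.floor_le (by positivity)
    _ = n := by field_simp

variable {𝒳 Ω : Type*} [MeasurableSpace 𝒳] [MeasurableSpace Ω]

/-- A transposition carries one marginal to the other. This is what allows all `L` columns to be
pooled to estimate the law of `T_m^{(1)}`. -/
lemma cdf_map_eq_of_exchangeable {A : Type*} [MeasurableSpace A] {L : ℕ} {Y : Fin L → A → ℝ}
    {μ : Measure A} (hY : ∀ l, Measurable (Y l)) (h : Exchangeable Y μ) (l l' : Fin L) :
    μ.map (Y l) = μ.map (Y l') := by
  have h1 := congrArg (Measure.map fun y : Fin L → ℝ => y l) (h (Equiv.swap l l'))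
  rw [Measure.map_map (by fun_prop) (by fun_prop), Measure.map_map (by fun_prop) (by fun_prop)] at h1
  have e : (fun y : Fin L → ℝ => y l) ∘ (fun a l₁ => Y (Equiv.swap l l' l₁) a) = Y l' := by
    funext a
    simp
  rw [e] at h1
  exact h1.symm

lemma card_rowIndex (J n : ℕ) : (Fintype.card (RowIndex J n) : ℝ) = J * numBlocks n := by
  simp

/-- The empirical distribution function of all statistics on subsamples concentrates. -/
lemma empiricalCDF_subsampledMatrix_deviation_le (P : Measure 𝒳) [IsProbabilityMeasure P]
    (PΩ : Measure Ω) [IsProbabilityMeasure PΩ] {J n L : ℕ} [NeZero L] (hJ : 0 < J)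
    (hK : 0 < numBlocks n) {T : Statistics 𝒳 Ω L} (hT : ∀ n l, Measurable (T n l))
    (hexch : ∀ n, Exchangeable (T n) (dataLaw P PΩ n)) (t : ℝ) {δ : ℝ} (hδ : 0 < δ) :
    (drawLaw P PΩ J n).real {d | δ < |empiricalCDF (fun q : RowIndex J n × Fin L =>
        subsampledMatrix T d.1.1 d.2.1 d.2.2 q.1 q.2) t
          - cdf ((dataLaw P PΩ (subsampleSize n)).map (T (subsampleSize n) 0)) t|}
      ≤ 1 / (numBlocks n * δ ^ 2) := by
  set m := subsampleSize n
  have hL : (0 : ℝ) < L := by exact_mod_cast Nat.pos_of_ne_zero (NeZero.ne L)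
  have hms : ∀ l, MeasurableSet {z | T m l z ≤ t} := fun l => measurableSet_le (hT m l) (by fun_prop)
  have hmeas : ∀ l, Measurable fun z => if T m l z ≤ t then (1 : ℝ) else 0 := fun l =>
    Measurable.ite (hms l) (by fun_prop) (by fun_prop)
  -- Each row is averaged first, so dependence among the entries of a row plays no role.
  have hdev := subsample_average_deviation_le P PΩ hJ hK
    (φ := fun z => (∑ l : Fin L, if T m l z ≤ t then (1 : ℝ) else 0) / L)
    ((Finset.measurable_sum _ fun l _ => hmeas l).div_const _)
    (fun z => div_nonneg (Finset.sum_nonneg fun l _ => by split_ifs <;> norm_num) hL.le)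
    (fun z => div_le_one_of_le₀ ((Finset.sum_le_sum (g := fun _ => (1 : ℝ)) fun l _ => by
      split_ifs <;> norm_num).trans (by simp)) hL.le) hδ
  have hint : ∫ z, (∑ l : Fin L, if T m l z ≤ t then (1 : ℝ) else 0) / L ∂dataLaw P PΩ m
      = cdf ((dataLaw P PΩ m).map (T m 0)) t := by
    have hl : ∀ l, ∫ z, (if T m l z ≤ t then (1 : ℝ) else 0) ∂dataLaw P PΩ m
        = cdf ((dataLaw P PΩ m).map (T m 0)) t := fun l => by
      rw [← cdf_map_eq_of_exchangeable (hT m) (hexch m) l 0, cdf_map_eq_real _ (hT m l),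
        ← integral_indicator_one (hms l)]
      rfl
    rw [integral_div, integral_finsetSum]
    · simp_rw [hl]
      simp [hL.ne']
    · exact fun l _ => Integrable.of_bound (hmeas l).aestronglyMeasurable 1
        (ae_of_all _ fun z => by split_ifs <;> norm_num)
  rw [hint] at hdev
  refine le_of_eq_of_le (congrArg _ (Set.ext fun d => ?_)) hdev
  have e : empiricalCDF (fun q : RowIndex J n × Fin L =>
        subsampledMatrix T d.1.1 d.2.1 d.2.2 q.1 q.2) t
      = (∑ b : RowIndex J n, (∑ l : Fin L,
        if T m l (subsampleData d b) ≤ t then (1 : ℝ) else 0) / L) / (J * numBlocks n : ℝ) := by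
    rw [empiricalCDF_eq_sum, Fintype.sum_prod_type, Fintype.card_prod, Nat.cast_mul, card_rowIndex,
      Fintype.card_fin, ← Finset.sum_div, div_div, mul_comm (L : ℝ)]
    rfl
  rw [Set.mem_ofPred_eq, Set.mem_ofPred_eq, e]

/-- The empirical distribution function of the aggregated statistics on subsamples concentrates. -/
lemma empiricalCDF_aggregate_deviation_le (P : Measure 𝒳) [IsProbabilityMeasure P]
    (PΩ : Measure Ω) [IsProbabilityMeasure PΩ] {J n L : ℕ} (hJ : 0 < J)
    (hK : 0 < numBlocks n) {T : Statistics 𝒳 Ω L} {S : (Fin L → ℝ) → ℝ}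
    (hS : ∀ n, Measurable (aggregate T S n)) (t : ℝ) {δ : ℝ} (hδ : 0 < δ) :
    (drawLaw P PΩ J n).real {d | δ < |empiricalCDF (fun b : RowIndex J n =>
        S (subsampledMatrix T d.1.1 d.2.1 d.2.2 b)) t
          - cdf ((dataLaw P PΩ (subsampleSize n)).map (aggregate T S (subsampleSize n))) t|}
      ≤ 1 / (numBlocks n * δ ^ 2) := by
  set m := subsampleSize n
  have hms : MeasurableSet {z | aggregate T S m z ≤ t} := measurableSet_le (hS m) (by fun_prop)
  have hdev := subsample_average_deviation_le P PΩ hJ hK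
    (φ := fun z => if aggregate T S m z ≤ t then (1 : ℝ) else 0)
    (Measurable.ite hms (by fun_prop) (by fun_prop))
    (fun z => by positivity) (fun z => by split_ifs <;> norm_num) hδ
  have hint : ∫ z, (if aggregate T S m z ≤ t then (1 : ℝ) else 0) ∂dataLaw P PΩ m
      = cdf ((dataLaw P PΩ m).map (aggregate T S m)) t := by
    rw [cdf_map_eq_real _ (hS m), ← integral_indicator_one hms]
    rfl
  rw [hint] at hdev
  refine le_of_eq_of_le (congrArg _ (Set.ext fun d => ?_)) hdev
  have e : empiricalCDF (fun b : RowIndex J n =>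
        S (subsampledMatrix T d.1.1 d.2.1 d.2.2 b)) t
      = (∑ b : RowIndex J n, if aggregate T S m (subsampleData d b) ≤ t then (1 : ℝ) else 0)
        / (J * numBlocks n : ℝ) := by
    rw [empiricalCDF_eq_sum, card_rowIndex]
    rfl
  rw [Set.mem_ofPred_eq, Set.mem_ofPred_eq, e]

end Subsamples

/-! ### Tightness and asymptotic size -/

section Size

variable {𝒳 Ω : Type*} [MeasurableSpace 𝒳] [MeasurableSpace Ω]

/-- Tail bound for the aggregated statistic in terms of the single-split statistics. -/
lemma aggregate_tail_le (P : Measure 𝒳) [IsProbabilityMeasure P] (PΩ : Measure Ω)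
    [IsProbabilityMeasure PΩ] {n L : ℕ} [NeZero L] {T : Statistics 𝒳 Ω L}
    (hT : ∀ n l, Measurable (T n l)) (hexch : ∀ n, Exchangeable (T n) (dataLaw P PΩ n))
    {S : (Fin L → ℝ) → ℝ} (hS : LipschitzWith 1 S) {a : ℝ} (ha : 0 ≤ a) :
    (dataLaw P PΩ n).real {z | a < |aggregate T S n z - S 0|}
      ≤ L * (cdf ((dataLaw P PΩ n).map (T n 0)) (-a)
        + (1 - cdf ((dataLaw P PΩ n).map (T n 0)) a)) := by
  have hsub : {z | a < |aggregate T S n z - S 0|}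
      ⊆ ⋃ l : Fin L, ({z | T n l z ≤ -a} ∪ {z | T n l z ≤ a}ᶜ) := by
    intro z hz
    by_contra hcon
    simp only [Set.mem_iUnion, Set.mem_union, Set.mem_compl_iff, Set.mem_ofPred_eq, not_exists,
      not_or, not_lt, not_le] at hcon
    have h1 := hS.dist_le_mul (fun l => T n l z) 0
    rw [NNReal.coe_one, one_mul, Real.dist_eq] at h1
    refine absurd (h1.trans ((dist_pi_le_iff ha).2 fun l => ?_)) (not_le.2 hz)
    rw [Real.dist_eq, Pi.zero_apply, sub_zero, abs_le]
    exact ⟨(hcon l).1.le, (hcon l).2⟩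
  refine (measureReal_mono hsub).trans ((measureReal_iUnion_fintype_le _).trans ?_)
  refine (Finset.sum_le_sum (g := fun _ => cdf ((dataLaw P PΩ n).map (T n 0)) (-a)
        + (1 - cdf ((dataLaw P PΩ n).map (T n 0)) a)) fun l _ => ?_).trans
    (by rw [Finset.sum_const, Finset.card_univ, Fintype.card_fin, nsmul_eq_mul])
  refine (measureReal_union_le _ _).trans ?_
  rw [← cdf_map_eq_of_exchangeable (hT n) (hexch n) l 0, cdf_map_eq_real _ (hT n l),
    cdf_map_eq_real _ (hT n l),
    probReal_compl_eq_one_sub (measurableSet_le (hT n l) (by fun_prop))]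

/-- The limits of the aggregated statistic are uniformly tight. -/
lemma exists_uniform_tail {PΩ : Measure Ω} [IsProbabilityMeasure PΩ]
    {𝒬 : Set (ProbabilityMeasure 𝒳)} {L : ℕ} [NeZero L] {T : Statistics 𝒳 Ω L}
    (hT : ∀ n l, Measurable (T n l))
    (hexch : ∀ P ∈ 𝒬, ∀ n, Exchangeable (T n) (dataLaw (P : Measure 𝒳) PΩ n)) {F₀ : Measure ℝ}
    {S : (Fin L → ℝ) → ℝ} (hS : LipschitzWith 1 S)
    {G : ProbabilityMeasure 𝒳 → ProbabilityMeasure ℝ}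
    (hF : ∀ x, ∀ ε > 0, ∀ᶠ n in atTop, ∀ P ∈ 𝒬,
      |cdf ((dataLaw (P : Measure 𝒳) PΩ n).map (T n 0)) x - cdf F₀ x| ≤ ε)
    (hG : ∀ x, ∀ ε > 0, ∀ᶠ n in atTop, ∀ P ∈ 𝒬,
      |cdf ((dataLaw (P : Measure 𝒳) PΩ n).map (aggregate T S n)) x
        - cdf (G P : Measure ℝ) x| ≤ ε) {ε : ℝ} (hε : 0 < ε) :
    ∃ M, ∀ P ∈ 𝒬, cdf (G P : Measure ℝ) (-M) ≤ ε ∧ 1 - ε ≤ cdf (G P : Measure ℝ) M := by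
  have hL : (0 : ℝ) < L := by exact_mod_cast Nat.pos_of_ne_zero (NeZero.ne L)
  -- Two tails of `F₀` and two approximation errors give `4 * δ` per coordinate, hence `ε / 2` over
  -- `L` coordinates.
  set δ := ε / (8 * L) with hδ
  have hδ0 : 0 < δ := by positivity
  have hLδ : L * (4 * δ) = ε / 2 := by rw [hδ]; field_simp; norm_num
  obtain ⟨a, ha1, ha2, ha0⟩ : ∃ a, cdf F₀ (-a) < δ ∧ 1 - δ < cdf F₀ a ∧ 0 < a := by
    have h1 : ∀ᶠ a : ℝ in atTop, cdf F₀ (-a) < δ :=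
      ((tendsto_cdf_atBot F₀).comp tendsto_neg_atTop_atBot).eventually (gt_mem_nhds hδ0)
    have h2 : ∀ᶠ a : ℝ in atTop, 1 - δ < cdf F₀ a :=
      (tendsto_cdf_atTop F₀).eventually (lt_mem_nhds (by linarith))
    exact (h1.and (h2.and (eventually_gt_atTop 0))).exists
  -- Beyond `±M` the aggregate differs from `S 0` by more than `a`; the `+ 1` gives strictness.
  set M := |S 0| + a + 1 with hM
  -- One `n` serves every law at once, so a tail bound at this `n` transfers to all `G P`.
  obtain ⟨n, h1, h2, h3, h4⟩ := ((hF (-a) δ hδ0).and ((hF a δ hδ0).and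
    ((hG (-M) (ε / 2) (by positivity)).and (hG M (ε / 2) (by positivity))))).exists
  refine ⟨M, fun P hP => ?_⟩
  have hSm : Measurable (aggregate T S n) :=
    hS.continuous.measurable.comp (measurable_pi_lambda _ (hT n))
  have htail := aggregate_tail_le (P : Measure 𝒳) PΩ (n := n) hT (hexch P hP) hS ha0.le
  have g1 := abs_le.1 (h1 P hP)
  have g2 := abs_le.1 (h2 P hP)
  have g3 := abs_le.1 (h3 P hP)
  have g4 := abs_le.1 (h4 P hP)
  have htail' := htail.trans (mul_le_mul_of_nonneg_left
    (show _ ≤ 4 * δ by linarith) hL.le)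
  rw [hLδ] at htail'
  have s0 := abs_le.1 (le_refl |S 0|)
  rw [cdf_map_eq_real _ hSm] at g3 g4
  have t1 : (dataLaw (P : Measure 𝒳) PΩ n).real {z | aggregate T S n z ≤ -M} ≤ ε / 2 := by
    refine (measureReal_mono fun z hz => ?_).trans htail'
    simp only [Set.mem_ofPred_eq] at hz ⊢
    rw [lt_abs]
    right
    linarith
  have t2 : 1 - (dataLaw (P : Measure 𝒳) PΩ n).real {z | aggregate T S n z ≤ M} ≤ ε / 2 := by
    rw [← probReal_compl_eq_one_sub (measurableSet_le hSm (by fun_prop))]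
    refine (measureReal_mono fun z hz => ?_).trans htail'
    simp only [Set.mem_ofPred_eq, Set.mem_compl_iff, not_le] at hz ⊢
    rw [lt_abs]
    left
    linarith
  constructor <;> linarith

/-- If the critical value lies between `x₁` and `x₂` outside an event `E`, the rejection
probability lies between the tail probabilities of the aggregated statistic. -/
lemma abs_rejectionProb_sub_le (P : Measure 𝒳) [IsProbabilityMeasure P] (PΩ : Measure Ω)
    [IsProbabilityMeasure PΩ] {J n L : ℕ} {T : Statistics 𝒳 Ω L} {S : (Fin L → ℝ) → ℝ}
    {F₀ : ℝ → ℝ} {α x₁ x₂ ε κ : ℝ} (hS : Measurable (aggregate T S n)) (E : Set (Draw 𝒳 Ω J n))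
    (hE : (drawLaw P PΩ J n).real E ≤ κ)
    (hq : ∀ d ∉ E, x₁ ≤ quantile (rankTransformedCDF T S F₀ d.1.1 d.2.1 d.2.2) (1 - α) ∧
      quantile (rankTransformedCDF T S F₀ d.1.1 d.2.1 d.2.2) (1 - α) ≤ x₂)
    (h₁ : 1 - α - ε ≤ cdf ((dataLaw P PΩ n).map (aggregate T S n)) x₁)
    (h₂ : cdf ((dataLaw P PΩ n).map (aggregate T S n)) x₂ ≤ 1 - α + ε) :
    |rejectionProb T S F₀ PΩ α J n P - α| ≤ ε + κ := by
  have htail : ∀ x, (drawLaw P PΩ J n).real {d | x < aggregate T S n d.1}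
      = 1 - cdf ((dataLaw P PΩ n).map (aggregate T S n)) x := fun x => by
    have hm : MeasurableSet {z | aggregate T S n z ≤ x} := measurableSet_le hS (by fun_prop)
    have hfst : MeasurePreserving (Prod.fst : Draw 𝒳 Ω J n → _) (drawLaw P PΩ J n)
      (dataLaw P PΩ n) := measurePreserving_fst
    rw [cdf_map_eq_real _ hS, ← probReal_compl_eq_one_sub hm, ← hfst.map_eq,
      map_measureReal_apply hfst.measurable hm.compl]
    congr 1
    ext d
    simp
  -- Only monotonicity and subadditivity are used, so neither `E` nor the rejection event has to be
  -- shown measurable.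
  have hup : rejectionProb T S F₀ PΩ α J n P
      ≤ (drawLaw P PΩ J n).real ({d | x₁ < aggregate T S n d.1} ∪ E) :=
    measureReal_mono fun d hd => by
      by_cases hdE : d ∈ E
      · exact Or.inr hdE
      · exact Or.inl ((hq d hdE).1.trans_lt hd)
  have hlo : (drawLaw P PΩ J n).real {d | x₂ < aggregate T S n d.1}
      ≤ (drawLaw P PΩ J n).real (rejectionEvent T S F₀ α J n ∪ E) :=
    measureReal_mono fun d hd => by
      by_cases hdE : d ∈ E
      · exact Or.inr hdE
      · exact Or.inl ((hq d hdE).2.trans_lt hd)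
  have hup' := hup.trans (measureReal_union_le _ _)
  have hlo' := hlo.trans (measureReal_union_le _ _)
  rw [htail] at hup' hlo'
  change _ ≤ rejectionProb T S F₀ PΩ α J n P + _ at hlo'
  rw [abs_le]
  constructor <;> linarith

/-- Uniform asymptotic size of the aggregated test. -/
lemma eventually_abs_rejectionProb_sub_le {PΩ : Measure Ω} [IsProbabilityMeasure PΩ]
    {𝒬 : Set (ProbabilityMeasure 𝒳)} {L J : ℕ} [NeZero L] (hJ : 0 < J) {T : Statistics 𝒳 Ω L}
    (hT : ∀ n l, Measurable (T n l))
    (hexch : ∀ P ∈ 𝒬, ∀ n, Exchangeable (T n) (dataLaw (P : Measure 𝒳) PΩ n)) {F₀ : Measure ℝ}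
    [IsProbabilityMeasure F₀] {C₀ : ℝ} (hF₀ : HasDensityBoundedBy F₀ C₀)
    (hstrict : ∀ x y, x < y → cdf F₀ x < 1 → 0 < cdf F₀ y → cdf F₀ x < cdf F₀ y)
    {S : (Fin L → ℝ) → ℝ} (hS : LipschitzWith 1 S)
    {G : ProbabilityMeasure 𝒳 → ProbabilityMeasure ℝ} {α : ℝ} (hα0 : 0 < α) (hα1 : α < 1)
    (hF : ∀ x, ∀ ε > 0, ∀ᶠ n in atTop, ∀ P ∈ 𝒬,
      |cdf ((dataLaw (P : Measure 𝒳) PΩ n).map (T n 0)) x - cdf F₀ x| ≤ ε)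
    (hG : ∀ x, ∀ ε > 0, ∀ᶠ n in atTop, ∀ P ∈ 𝒬,
      |cdf ((dataLaw (P : Measure 𝒳) PΩ n).map (aggregate T S n)) x
        - cdf (G P : Measure ℝ) x| ≤ ε)
    {C : ℝ} (hC0 : 0 ≤ C) (hC : ∀ P ∈ 𝒬, HasDensityBoundedBy (G P : Measure ℝ) C)
    {ε : ℝ} (hε : 0 < ε) :
    ∀ᶠ n in atTop, ∀ P ∈ 𝒬,
      |rejectionProb T S (fun x => cdf F₀ x) PΩ α J n (P : Measure 𝒳) - α| ≤ ε := by
  have hL : (0 : ℝ) < L := by exact_mod_cast Nat.pos_of_ne_zero (NeZero.ne L)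
  have hSm : ∀ n, Measurable (aggregate T S n) := fun n =>
    hS.continuous.measurable.comp (measurable_pi_lambda _ (hT n))
  -- The final error is `6 * κ` from the tails plus `κ` from the exceptional event. The other bounds
  -- keep the levels `1 - α ± 5 * κ` inside `(0, 1)`.
  obtain ⟨κ, hκ0, hκε, hκα, hκα'⟩ : ∃ κ > 0, 7 * κ ≤ ε ∧ 6 * κ ≤ α ∧ 6 * κ ≤ 1 - α := by
    refine ⟨min (ε / 7) (min (α / 6) ((1 - α) / 6)), ?_, ?_, ?_, ?_⟩
    · have : 0 < (1 - α) / 6 := by linarith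
      positivity
    · linarith [min_le_left (ε / 7) (min (α / 6) ((1 - α) / 6))]
    · linarith [(min_le_right (ε / 7) (min (α / 6) ((1 - α) / 6))).trans (min_le_left _ _)]
    · linarith [(min_le_right (ε / 7) (min (α / 6) ((1 - α) / 6))).trans (min_le_right _ _)]
  set r := κ / (C + 1) with hr
  have hr0 : 0 < r := by positivity
  have hCr : C * r ≤ κ := by
    rw [hr, mul_div_assoc', div_le_iff₀ (by positivity)]
    nlinarith
  obtain ⟨D, δ, hδ0, hD⟩ := exists_rankTransform_control (F₀ := fun x => cdf F₀ x)
    (monotone_cdf F₀) (cdf_nonneg F₀) (cdf_le_one F₀) (tendsto_cdf_atBot F₀)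
    (tendsto_cdf_atTop F₀) hF₀.nonneg (fun x y h => hF₀.cdf_sub_le h) hF₀.continuous_cdf hstrict
    hS (η := κ / L) (r := r) (by positivity) hr0
  rw [mul_div_cancel₀ _ hL.ne'] at hD
  obtain ⟨M, hM⟩ := exists_uniform_tail hT hexch hS hF hG (half_pos hκ0)
  obtain ⟨D', hD'⟩ := exists_finset_forall_abs_sub_le (M := M) hC0 (half_pos hκ0)
  have hGu : ∀ᶠ n in atTop, ∀ P ∈ 𝒬, ∀ x,
      |cdf ((dataLaw (P : Measure 𝒳) PΩ n).map (aggregate T S n)) x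
        - cdf (G P : Measure ℝ) x| ≤ κ := by
    filter_upwards [(Filter.eventually_all_finset D').2 fun t _ => hG t (κ / 2) (half_pos hκ0)]
      with n hn P hP x
    have := hD' (cdf (G P : Measure ℝ)) (cdf ((dataLaw (P : Measure 𝒳) PΩ n).map (aggregate T S n)))
      (monotone_cdf _) (monotone_cdf _) (cdf_nonneg _) (cdf_le_one _) (cdf_nonneg _)
      (cdf_le_one _) (fun x y h => (hC P hP).cdf_sub_le h) (hM P hP).1 (hM P hP).2
      (fun t ht => hn t ht P hP) x
    linarith
  have hFD : ∀ᶠ n in atTop, ∀ t ∈ D, ∀ P ∈ 𝒬,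
      |cdf ((dataLaw (P : Measure 𝒳) PΩ n).map (T n 0)) t - cdf F₀ t| ≤ δ / 2 :=
    (Filter.eventually_all_finset D).2 fun t _ => hF t (δ / 2) (half_pos hδ0)
  have hKlim : Tendsto (fun n => (numBlocks n : ℝ)) atTop atTop :=
    tendsto_natCast_atTop_atTop.comp tendsto_numBlocks
  -- The Chebyshev bounds for the grid `D` and for the two points `x₁ + r`, `x₂ - r` add up to `A /
  -- numBlocks n`.
  set A := (D.card : ℝ) * (1 / (δ / 2) ^ 2) + 2 * (1 / κ ^ 2) with hA
  filter_upwards [hGu, tendsto_subsampleSize.eventually hGu, tendsto_subsampleSize.eventually hFD,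
    hKlim.eventually_ge_atTop (A / κ), hKlim.eventually_ge_atTop (1 / δ),
    hKlim.eventually_gt_atTop 0] with n hGn hGm hFm hKA hKδ hK0 P hP
  have hK : 0 < numBlocks n := by exact_mod_cast hK0
  have hJ1 : (1 : ℝ) ≤ J := by exact_mod_cast hJ
  have hL1 : (1 : ℝ) ≤ L := by exact_mod_cast Nat.pos_of_ne_zero (NeZero.ne L)
  have hcard : 1 / (2 * (Fintype.card (RowIndex J n) : ℝ) * (L : ℝ)) ≤ δ := by
    rw [card_rowIndex, div_le_iff₀ (by positivity)]
    rw [div_le_iff₀ hδ0] at hKδ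
    have h1 : 1 ≤ (J : ℝ) * L := one_le_mul_of_one_le_of_one_le hJ1 hL1
    have h2 : 1 ≤ (numBlocks n * δ) * (J * L) := one_le_mul_of_one_le_of_one_le hKδ h1
    linarith
  have : Nonempty (RowIndex J n) := ⟨(⟨0, hJ⟩, ⟨0, hK⟩)⟩
  have hivt : ∀ p, 0 < p → p < 1 → ∃ x, cdf (G P : Measure ℝ) x = p := fun p hp0 hp1 =>
    mem_range_of_exists_le_of_exists_ge (hC P hP).continuous_cdf
      (((tendsto_cdf_atBot _).eventually (gt_mem_nhds hp0)).exists.imp fun _ h => h.le)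
      (((tendsto_cdf_atTop _).eventually (lt_mem_nhds hp1)).exists.imp fun _ h => h.le)
  -- Passing from the transformed empirical function to `G P` costs `κ` four times: rank transform,
  -- concentration, convergence at size `m`, shift by `r`. The fifth `κ` makes the inequality at
  -- `x₁` strict.
  obtain ⟨x₁, hx₁⟩ := hivt (1 - α - 5 * κ) (by linarith) (by linarith)
  obtain ⟨x₂, hx₂⟩ := hivt (1 - α + 5 * κ) (by linarith) (by linarith)
  set m := subsampleSize n
  set Fhat : Draw 𝒳 Ω J n → ℝ → ℝ := fun d => empiricalCDF fun q : RowIndex J n × Fin L =>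
    subsampledMatrix T d.1.1 d.2.1 d.2.2 q.1 q.2
  set Ghat : Draw 𝒳 Ω J n → ℝ → ℝ := fun d => empiricalCDF fun b : RowIndex J n =>
    S (subsampledMatrix T d.1.1 d.2.1 d.2.2 b)
  set Fm := cdf ((dataLaw (P : Measure 𝒳) PΩ m).map (T m 0))
  set Gm := cdf ((dataLaw (P : Measure 𝒳) PΩ m).map (aggregate T S m))
  set E : Set (Draw 𝒳 Ω J n) := (⋃ t ∈ D, {d | δ / 2 < |Fhat d t - Fm t|}) ∪
    ({d | κ < |Ghat d (x₁ + r) - Gm (x₁ + r)|} ∪ {d | κ < |Ghat d (x₂ - r) - Gm (x₂ - r)|})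
    with hEdef
  have hE : (drawLaw (P : Measure 𝒳) PΩ J n).real E ≤ κ := by
    have h1 : (drawLaw (P : Measure 𝒳) PΩ J n).real (⋃ t ∈ D, {d | δ / 2 < |Fhat d t - Fm t|})
        ≤ D.card * (1 / (numBlocks n * (δ / 2) ^ 2)) := by
      refine (measureReal_biUnion_finset_le _ _).trans ((Finset.sum_le_sum fun t _ =>
        empiricalCDF_subsampledMatrix_deviation_le (P : Measure 𝒳) PΩ hJ hK hT (hexch P hP) t
          (half_pos hδ0)).trans ?_)
      simp
    have h2 : ∀ x, (drawLaw (P : Measure 𝒳) PΩ J n).real {d | κ < |Ghat d x - Gm x|}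
        ≤ 1 / (numBlocks n * κ ^ 2) := fun x =>
      empiricalCDF_aggregate_deviation_le (P : Measure 𝒳) PΩ hJ hK hSm x hκ0
    calc _ ≤ D.card * (1 / (numBlocks n * (δ / 2) ^ 2))
          + (1 / (numBlocks n * κ ^ 2) + 1 / (numBlocks n * κ ^ 2)) :=
          (measureReal_union_le _ _).trans (add_le_add h1
            ((measureReal_union_le _ _).trans (add_le_add (h2 _) (h2 _))))
      _ = A / numBlocks n := by
          rw [hA]
          field_simp
          ring
      _ ≤ κ := by
          rw [div_le_iff₀ hκ0] at hKA
          rw [div_le_iff₀ hK0]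
          linarith
  have hlip := fun x y h => (hC P hP).cdf_sub_le (x := x) (y := y) h
  refine (abs_rejectionProb_sub_le (P : Measure 𝒳) PΩ (x₁ := x₁) (x₂ := x₂) (ε := 6 * κ)
    (hSm n) E hE (fun d hd => ?_) ?_ ?_).trans (by linarith)
  · simp only [hEdef, Set.mem_union, Set.mem_iUnion, Set.mem_ofPred_eq, not_or, not_exists,
      not_lt, exists_prop, not_and] at hd
    obtain ⟨hd1, hd2, hd3⟩ := hd
    have hctl := hD (RowIndex J n) (subsampledMatrix T d.1.1 d.2.1 d.2.2) hcard fun t ht => by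
      have h1 := abs_le.1 (hd1 t ht)
      have h2 := abs_le.1 (hFm t ht P hP)
      rw [abs_le]
      constructor <;> linarith
    refine le_quantile_and_quantile_le (monotone_empiricalCDF _)
      ((hctl x₁).1.trans_lt ?_) ?_
    · have h1 := (abs_le.1 hd2).2
      have h2 := (abs_le.1 (hGm P hP (x₁ + r))).2
      have h3 := hlip x₁ (x₁ + r) (by linarith)
      rw [add_sub_cancel_left] at h3
      linarith
    · have h0 := (hctl x₂).2
      have h1 := (abs_le.1 hd3).1
      have h2 := (abs_le.1 (hGm P hP (x₂ - r))).1
      have h3 := hlip (x₂ - r) x₂ (by linarith)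
      rw [sub_sub_cancel] at h3
      change 1 - α ≤ empiricalCDF (fun b => S (rankTransform (fun x => cdf F₀ x)
        (subsampledMatrix T d.1.1 d.2.1 d.2.2) b)) x₂
      linarith
  · have := (abs_le.1 (hGn P hP x₁)).1
    linarith
  · have := (abs_le.1 (hGn P hP x₂)).2
    linarith

/-- Convergence of a supremum of bounded nonnegative quantities to zero is uniform convergence. -/
lemma tendsto_iSup_zero_iff {ι : Type*} {s : Set ι} {f : ℕ → ι → ℝ} (h0 : ∀ n i, 0 ≤ f n i)
    {B : ℝ} (hB : ∀ n i, f n i ≤ B) :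
    Tendsto (fun n => ⨆ i : s, f n i) atTop (𝓝 0) ↔
      ∀ ε > 0, ∀ᶠ n in atTop, ∀ i ∈ s, f n i ≤ ε := by
  -- Without boundedness the real supremum would default to `0` and carry no information.
  have hbdd : ∀ n, BddAbove (Set.range fun i : s => f n i) := fun n =>
    ⟨B, by rintro _ ⟨i, rfl⟩; exact hB n i⟩
  constructor
  · intro h ε hε
    filter_upwards [h.eventually (gt_mem_nhds hε)] with n hn i hi
    exact (le_ciSup (hbdd n) ⟨i, hi⟩).trans hn.le
  · intro h
    refine Metric.tendsto_nhds.2 fun ε hε => ?_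
    filter_upwards [h (ε / 2) (half_pos hε)] with n hn
    rw [Real.dist_eq, sub_zero, abs_of_nonneg (Real.iSup_nonneg fun i : s => h0 n i)]
    exact (Real.iSup_le (fun i : s => hn i i.2) (half_pos hε).le).trans_lt (half_lt_self hε)

lemma abs_sub_le_one_of_mem_Icc {a b : ℝ} (ha0 : 0 ≤ a) (ha1 : a ≤ 1) (hb0 : 0 ≤ b) (hb1 : b ≤ 1) :
    |a - b| ≤ 1 := by
  rw [abs_le]
  constructor <;> linarith

end Size

end RankSubsampling

/-! ### The pointwise and the uniform statement -/

open RankSubsampling in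
theorem theorem1 {𝒳 Ω : Type*} [MeasurableSpace 𝒳] [MeasurableSpace Ω]
    (PΩ : Measure Ω) [IsProbabilityMeasure PΩ]
    (𝒫₀ : Set (ProbabilityMeasure 𝒳))
    (L : ℕ) [NeZero L] (J : ℕ) (hJ : 0 < J)
    (T : Statistics 𝒳 Ω L) (hT : ∀ n l, Measurable (T n l))
    (hexch : ∀ P ∈ 𝒫₀, ∀ n, Exchangeable (T n) (dataLaw (P : Measure 𝒳) PΩ n))
    (F₀ : Measure ℝ) [IsProbabilityMeasure F₀]
    (hF₀ : F₀ = volume.restrict (Set.Ioo (0 : ℝ) 1) ∨ F₀ = gaussianReal 0 1)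
    (hpivot : ∀ P ∈ 𝒫₀, TendstoInDistribution (fun n => T n 0) atTop (id : ℝ → ℝ)
      (fun n => dataLaw (P : Measure 𝒳) PΩ n) F₀)
    (S : (Fin L → ℝ) → ℝ) (hSsymm : SymmetricFun S) (hSlip : LipschitzWith 1 S)
    (G : ProbabilityMeasure 𝒳 → ProbabilityMeasure ℝ)
    (α : ℝ) (hα0 : 0 < α) (hα1 : α < 1) :
    -- (i) pointwise size
    ((∀ P ∈ 𝒫₀,
        TendstoInDistribution (fun n => aggregate T S n) atTop (id : ℝ → ℝ)
          (fun n => dataLaw (P : Measure 𝒳) PΩ n) (G P : Measure ℝ) ∧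
        Continuous (fun x => cdf (G P : Measure ℝ) x) ∧
        ∃ C : ℝ, HasDensityBoundedBy (G P : Measure ℝ) C) →
      ∀ P ∈ 𝒫₀, Tendsto
        (fun n => rejectionProb T S (fun x => cdf F₀ x) PΩ α J n (P : Measure 𝒳))
        atTop (𝓝 α)) ∧
    -- (ii) uniform size
    ((∀ x : ℝ, Tendsto
        (fun n => ⨆ P : 𝒫₀,
          |cdf ((dataLaw ((P : ProbabilityMeasure 𝒳) : Measure 𝒳) PΩ n).map (T n 0)) x
            - cdf F₀ x|)
        atTop (𝓝 0)) →
      (∀ x : ℝ, Tendsto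
        (fun n => ⨆ P : 𝒫₀,
          |cdf ((dataLaw ((P : ProbabilityMeasure 𝒳) : Measure 𝒳) PΩ n).map (aggregate T S n)) x
            - cdf (G (P : ProbabilityMeasure 𝒳) : Measure ℝ) x|)
        atTop (𝓝 0)) →
      (∃ C : ℝ, ∀ P ∈ 𝒫₀, HasDensityBoundedBy (G P : Measure ℝ) C) →
      Tendsto
        (fun n => ⨆ P : 𝒫₀,
          |rejectionProb T S (fun x => cdf F₀ x) PΩ α J n
              ((P : ProbabilityMeasure 𝒳) : Measure 𝒳) - α|)
        atTop (𝓝 0)) := by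
  obtain ⟨C₀, hC₀⟩ : ∃ C₀, HasDensityBoundedBy F₀ C₀ := by
    rcases hF₀ with h | h
    · exact ⟨1, h ▸ hasDensityBoundedBy_uniform⟩
    · exact ⟨1, h ▸ hasDensityBoundedBy_gaussian⟩
  have hstrict : ∀ x y, x < y → cdf F₀ x < 1 → 0 < cdf F₀ y → cdf F₀ x < cdf F₀ y :=
    fun x y => cdf_lt_cdf_of_uniform_or_gaussian hF₀
  refine ⟨fun h P hP => ?_, fun hF hG hC => ?_⟩
  · obtain ⟨hlim, -, C, hC⟩ := h P hP
    refine Metric.tendsto_nhds.2 fun ε hε => ?_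
    have hev : ∀ {f : ℕ → ProbabilityMeasure 𝒳 → ℝ} {c : ℝ},
        Tendsto (fun n => f n P) atTop (𝓝 c) → ∀ ε > 0, ∀ᶠ n in atTop,
          ∀ Q ∈ ({P} : Set (ProbabilityMeasure 𝒳)), |f n Q - c| ≤ ε := fun hf ε hε => by
      filter_upwards [Metric.tendsto_nhds.1 hf ε hε] with n hn Q hQ
      rw [Set.mem_singleton_iff.1 hQ]
      exact hn.le
    -- Pointwise size is uniform size over the class `{P}`, where a density bound depending on `P`
    -- suffices.
    have := eventually_abs_rejectionProb_sub_le (PΩ := PΩ) (𝒬 := {P}) hJ hT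
      (fun Q hQ => hexch Q (by rwa [Set.mem_singleton_iff.1 hQ])) hC₀ hstrict hSlip
      (G := fun _ => G P) hα0 hα1
      (fun x => hev (tendsto_cdf_map_of_tendstoInDistribution (hpivot P hP) hC₀ x))
      (fun x => hev (tendsto_cdf_map_of_tendstoInDistribution hlim hC x))
      hC.nonneg (fun _ _ => hC) (half_pos hε)
    filter_upwards [this] with n hn
    exact (hn P rfl).trans_lt (half_lt_self hε)
  · obtain ⟨C, hC⟩ := hC
    refine (tendsto_iSup_zero_iff (s := 𝒫₀) (f := fun n P =>
      |rejectionProb T S (fun x => cdf F₀ x) PΩ α J n (P : Measure 𝒳) - α|) (B := 1)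
      (fun _ _ => abs_nonneg _) (fun n P => abs_sub_le_one_of_mem_Icc measureReal_nonneg
        measureReal_le_one hα0.le hα1.le)).2 fun ε hε => ?_
    exact eventually_abs_rejectionProb_sub_le hJ hT hexch hC₀ hstrict hSlip hα0 hα1
      (fun x => (tendsto_iSup_zero_iff (s := 𝒫₀) (f := fun n P =>
        |cdf ((dataLaw (P : Measure 𝒳) PΩ n).map (T n 0)) x - cdf F₀ x|) (B := 1)
        (fun _ _ => abs_nonneg _) (fun n P => abs_sub_le_one_of_mem_Icc (cdf_nonneg _ _)
          (cdf_le_one _ _) (cdf_nonneg _ _) (cdf_le_one _ _))).1 (hF x))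
      (fun x => (tendsto_iSup_zero_iff (s := 𝒫₀) (f := fun n P =>
        |cdf ((dataLaw (P : Measure 𝒳) PΩ n).map (aggregate T S n)) x
          - cdf (G P : Measure ℝ) x|) (B := 1)
        (fun _ _ => abs_nonneg _) (fun n P => abs_sub_le_one_of_mem_Icc (cdf_nonneg _ _)
          (cdf_le_one _ _) (cdf_nonneg _ _) (cdf_le_one _ _))).1 (hG x))
      -- If `𝒫₀` is empty, nothing forces `C` to be nonnegative.
      (le_max_right C 0) (fun P hP => by
        rw [max_eq_left (hC P hP).nonneg]
        exact hC P hP) hε
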